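/- Let $Y$ be a real random variable and let $X_{nc}\in\mathbb{R}^p$ ($p\ge 1$) and $X_c\in\mathbb{R}^d$ be random vectors on a common probability space, with $E(Y^2)<\infty$. Fix any versions of the conditional laws of $Y$ and of $X_{nc}$ given $X_c=x$. Write $m_Y(x)=E(Y|X_c=x)$, $m_X(x)=E(X_{nc}|X_c=x)$, $Y^x=Y-m_Y(x)$ and $X^x=X_{nc}-m_X(x)$. Suppose that for $P_{X_c}$-almost every $x$ the conditional second moments of $X_{nc}$ given $X_c=x$ are finite and $E(X^xX^{x\prime}|X_c=x)$ is nonsingular, and that $E(Y|X_{nc},X_c)=f_0(X_c)+X_{nc}'\beta_0$ a.s. for some measurable $f_0$ and some $\beta_0\in\mathbb{R}^p$. Only the laws of $(Y,X_c)$ and $(X_{nc},X_c)$ are known. Call $(\beta,f)$, with $\beta\in\mathbb{R}^p$ and $f:\mathbb{R}^d\to\mathbb{R}$ measurable, compatible if there are random variables $(\tilde Y,\tilde X_{nc},\tilde X_c)$ such that $(\tilde Y,\tilde X_c)$ and $(\tilde X_{nc},\tilde X_c)$ have the same laws as $(Y,X_c)$ and $(X_{nc},X_c)$ respectively, and $E(\tilde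 Y|\tilde X_{nc},\tilde X_c)=f(\tilde X_c)+\tilde X_{nc}'\beta$ a.s. Let $\mathcal{B}^c$ (resp. $\mathcal{F}$), the identified set of $\beta_0$ (resp. of $f_0$), be the set of all $\beta$ (resp. $f$) that belong to some compatible pair. For cdfs $F,G$ with mean zero let $F^{-1}(t)=\inf\{x:F(x)\ge t\}$ and $$S(F,G)=\inf_{\alpha\in(0,1)}\frac{\int_\alpha^1F^{-1}(t)\,dt}{\int_\alpha^1G^{-1}(t)\,dt}.$$ Then: 1. $\mathcal{B}^c=\{\lambda q:\ \|q\|=1,\ 0\le\lambda\le\overline S(q)\}$, where $\overline S(q)=\operatorname{ess\,inf}_{x}\,S\big(F_{Y^x|X_c=x},F_{X^{x\prime}q|X_c=x}\big)$ and the essential infimum is with respect to the law of $X_c$. 2. Suppose moreover that at every $x\in\mathrm{Supp}(X_c)$ the conditional law of $Y$ has a finite mean, that of $X_{nc}$ has finite second moments, $E(X^xX^{x\prime}|X_c=x)$ is nonsingular, and either $P(X_c=x)>0$ or both conditional laws are continuous at $x$, within $\mathrm{Supp}(X_c)$, for the 1-Wasserstein distance (this covers every $X_c$ with finite support). Then the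 formula of part 1 holds with $\overline S(q)=\inf_{x\in\mathrm{Supp}(X_c)}S\big(F_{Y^x|X_c=x},F_{X^{x\prime}q|X_c=x}\big)$. 3. $\mathcal{F}$ is the set of functions $x\mapsto m_Y(x)-m_X(x)'\beta$ with $\beta\in\mathcal{B}^c$, up to equality almost everywhere with respect to the law of $X_c$. 4. $\mathcal{B}^c$ contains $0$ and is compact and convex. -/

import Mathlib

open MeasureTheory ProbabilityTheory Filter Topology

noncomputable section

/-- Generalized inverse `F⁻¹(t) = inf {x : F x ≥ t}` of a cumulative distribution function. -/
def genInv (F : ℝ → ℝ) (t : ℝ) : ℝ := sInf {x : ℝ | t ≤ F x}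

/-- Ratio of superquantiles `R(α, F, G) = ∫_α^1 F⁻¹(t) dt / ∫_α^1 G⁻¹(t) dt`. -/
def superquantileRatio (α : ℝ) (F G : ℝ → ℝ) : ℝ :=
  (∫ t in α..1, genInv F t) / ∫ t in α..1, genInv G t

/-- `S(F, G) = inf_{α ∈ (0,1)} R(α, F, G)`, as an extended real number. -/
def radialS (F G : ℝ → ℝ) : EReal :=
  ⨅ α ∈ Set.Ioo (0 : ℝ) 1, (superquantileRatio α F G : EReal)

/-- `E(V | X_c = x)`, where `κ x` is the conditional law of `V` given `X_c = x`. -/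
def condMean {C E : Type*} [MeasurableSpace C] [NormedAddCommGroup E] [NormedSpace ℝ E]
    [MeasurableSpace E] (κ : Kernel C E) (x : C) : E :=
  ∫ v, v ∂(κ x)

/-- The matrix `E(X^x X^x' | X_c = x)`, where `X^x = X_nc - E(X_nc | X_c = x)` and `κ x` is the
conditional law of `X_nc` given `X_c = x`. -/
def condCovMatrix {C : Type*} [MeasurableSpace C] {p : ℕ}
    (κ : Kernel C (EuclideanSpace ℝ (Fin p))) (x : C) : Matrix (Fin p) (Fin p) ℝ :=
  Matrix.of fun i j => ∫ v, (v - condMean κ x) i * (v - condMean κ x) j ∂(κ x)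

/-- The cdf of `Y^x = Y - E(Y | X_c = x)` conditional on `X_c = x`. -/
def cdfResidualY {C : Type*} [MeasurableSpace C] (κY : Kernel C ℝ) (x : C) : ℝ → ℝ :=
  cdf ((κY x).map fun y => y - condMean κY x)

/-- The cdf of `X^x'q`, `X^x = X_nc - E(X_nc | X_c = x)`, conditional on `X_c = x`. -/
def cdfResidualX {C : Type*} [MeasurableSpace C] {p : ℕ}
    (κX : Kernel C (EuclideanSpace ℝ (Fin p))) (q : EuclideanSpace ℝ (Fin p)) (x : C) : ℝ → ℝ :=
  cdf ((κX x).map fun v => inner ℝ (v - condMean κX x) q)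

/-- `S(F_{Y^x | X_c = x}, F_{X^x'q | X_c = x})`. -/
def condRadialS {C : Type*} [MeasurableSpace C] {p : ℕ} (κY : Kernel C ℝ)
    (κX : Kernel C (EuclideanSpace ℝ (Fin p))) (q : EuclideanSpace ℝ (Fin p)) (x : C) : EReal :=
  radialS (cdfResidualY κY x) (cdfResidualX κX q x)

/-- The set `{λ q : ‖q‖ = 1, 0 ≤ λ ≤ r q}`. -/
def starSet {p : ℕ} (r : EuclideanSpace ℝ (Fin p) → EReal) : Set (EuclideanSpace ℝ (Fin p)) :=
  {b | ∃ q : EuclideanSpace ℝ (Fin p), ‖q‖ = 1 ∧ ∃ l : ℝ, 0 ≤ l ∧ (l : EReal) ≤ r q ∧ b = l • q}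

/-- `(b, g)` is compatible with the partially linear model and with the laws `Pcy` of `(X_c, Y)`
and `Pcx` of `(X_c, X_nc)`: some joint law `ρ` of `(X_c, X_nc, Y)` has these two marginals and
satisfies `E(Y | X_c, X_nc) = g(X_c) + X_nc'b` almost surely. -/
def Rationalizes {C : Type*} [MeasurableSpace C] {p : ℕ} (Pcy : Measure (C × ℝ))
    (Pcx : Measure (C × EuclideanSpace ℝ (Fin p))) (b : EuclideanSpace ℝ (Fin p)) (g : C → ℝ) :
    Prop :=
  ∃ ρ : Measure (C × EuclideanSpace ℝ (Fin p) × ℝ),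
    ρ.map (fun z => (z.1, z.2.2)) = Pcy ∧
    ρ.map (fun z => (z.1, z.2.1)) = Pcx ∧
    Integrable (fun z => z.2.2) ρ ∧
    ρ[fun z => z.2.2 | MeasurableSpace.comap
        (fun z : C × EuclideanSpace ℝ (Fin p) × ℝ => (z.1, z.2.1)) inferInstance]
      =ᵐ[ρ] fun z => g z.1 + inner ℝ z.2.1 b

/-- Identified set of the slope. -/
def identifiedSlope {C : Type*} [MeasurableSpace C] {p : ℕ} (Pcy : Measure (C × ℝ))
    (Pcx : Measure (C × EuclideanSpace ℝ (Fin p))) : Set (EuclideanSpace ℝ (Fin p)) :=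
  {b | ∃ g : C → ℝ, Measurable g ∧ Rationalizes Pcy Pcx b g}

/-- Identified set of the nonparametric component. -/
def identifiedFun {C : Type*} [MeasurableSpace C] {p : ℕ} (Pcy : Measure (C × ℝ))
    (Pcx : Measure (C × EuclideanSpace ℝ (Fin p))) : Set (C → ℝ) :=
  {g | Measurable g ∧ ∃ b, Rationalizes Pcy Pcx b g}

/-- Continuity at `x` within `s` of `z ↦ κ z` for convergence in 1-Wasserstein distance, that is,
convergence of the integrals of all continuous functions of at most linear growth. -/
def W1ContinuousWithinAt {C E : Type*} [MeasurableSpace C] [TopologicalSpace C]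
    [NormedAddCommGroup E] [MeasurableSpace E] (κ : Kernel C E) (s : Set C) (x : C) : Prop :=
  ∀ h : E → ℝ, Continuous h → (∃ K : ℝ, ∀ v, |h v| ≤ K * (1 + ‖v‖)) →
    Tendsto (fun z => ∫ v, h v ∂(κ z)) (𝓝[s] x) (𝓝 (∫ v, h v ∂(κ x)))

end

/-! Everything reduces to one equivalence: `(b, g)` is compatible iff `g = m_Y - m_X'b` almost
everywhere and, for almost every `x`, the law of `X^x'b` given `X_c = x` lies below that of `Y^x` in
the convex order. Since both residuals have mean zero, this order is domination of the stop-loss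
transforms `t ↦ E(· - t)⁺`, the condition `b ∈ convexOrderSlopes κY κX x`.

Necessity (`Rationalizes.ae_mem_convexOrderSlopes`) is conditional Jensen. Sufficiency is Strassen's
theorem with measurable dependence on `x`. Instead of selecting a coupling for each `x`,
`exists_martingale_coupling` builds one explicitly on `C × (0,1)`. With `ξ`, `η` the quantile
functions of the smaller and larger law, nested tail integrals place the mass of `(ξ - η)⁺` to the
left of that of `(η - ξ)⁺`. These parts are coupled monotonically, and `exists_swap_coupling`
exchanges levels along that coupling until `η` has conditional mean `ξ`. This couples `Y` only with
the scalar index `g(X_c) + X_nc'b`; `exists_glue` restores the full vector `X_nc`.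

The function `S` enters by duality between tail integrals and stop-loss transforms
(`tail_le_iff_posPart_le`). Nonsingularity makes the denominators positive, so `l ≤ S` says exactly
that `l • q` is an admissible slope (`le_condRadialS_iff`). For almost every `x` the admissible
slopes form a closed, convex, bounded set containing `0`, and these properties pass to the
identified set. -/

noncomputable section

/-! ### Quantile functions of finite measures -/

/-- The quantile function of a finite measure on the line, set to `0` outside `(0, σ(ℝ))`. -/
def quantileFun (σ : Measure ℝ) (t : ℝ) : ℝ :=
  (Set.Ioo 0 (σ.real Set.univ)).indicator (genInv fun y => σ.real (Set.Iic y)) t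

lemma isFiniteMeasure_of_real_univ_pos {σ : Measure ℝ} (h : 0 < σ.real Set.univ) :
    IsFiniteMeasure σ := by
  refine ⟨lt_top_iff_ne_top.2 fun h' => ?_⟩
  simp [measureReal_def, h'] at h

/-- The limits of the distribution function at `±∞` make the defining set nonempty and bounded
below, and right continuity makes its infimum attained. All later facts on quantiles rest on this
Galois connection. -/
lemma genInv_le_iff (σ : Measure ℝ) {t : ℝ} (ht : t ∈ Set.Ioo 0 (σ.real Set.univ)) (y : ℝ) :
    genInv (fun z => σ.real (Set.Iic z)) t ≤ y ↔ t ≤ σ.real (Set.Iic y) := by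
  have := isFiniteMeasure_of_real_univ_pos (ht.1.trans ht.2)
  have hmono : Monotone fun z => σ.real (Set.Iic z) := fun a b hab =>
    measureReal_mono (Set.Iic_subset_Iic.2 hab)
  have hne : {x : ℝ | t ≤ σ.real (Set.Iic x)}.Nonempty := by
    have h1 : Tendsto (fun x : ℝ => σ.real (Set.Iic x)) atTop (𝓝 (σ.real Set.univ)) :=
      (ENNReal.tendsto_toReal (measure_ne_top _ _)).comp (tendsto_measure_Iic_atTop σ)
    obtain ⟨x, hx⟩ := (h1.eventually (lt_mem_nhds ht.2)).exists
    exact ⟨x, hx.le⟩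
  have hbdd : BddBelow {x : ℝ | t ≤ σ.real (Set.Iic x)} := by
    have h0 : Tendsto (fun x : ℝ => σ (Set.Iic x)) atBot (𝓝 (σ (⋂ x : ℝ, Set.Iic x))) :=
      tendsto_measure_iInter_atBot (fun x => measurableSet_Iic.nullMeasurableSet)
        monotone_Iic ⟨0, measure_ne_top _ _⟩
    have h1 : Tendsto (fun x : ℝ => σ.real (Set.Iic x)) atBot (𝓝 0) := by
      have hempty : ∀ z : ℝ, z ∉ ⋂ x : ℝ, Set.Iic x := fun z hz => by
        have := Set.mem_iInter.1 hz (z - 1)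
        simp only [Set.mem_Iic] at this
        linarith
      have := (ENNReal.tendsto_toReal (measure_ne_top _ _)).comp h0
      rw [Set.eq_empty_iff_forall_notMem.2 hempty, measure_empty, ENNReal.toReal_zero] at this
      exact this
    obtain ⟨b, hb⟩ := (h1.eventually (gt_mem_nhds ht.1)).exists
    refine ⟨b, fun x hx => ?_⟩
    by_contra! hxb
    exact absurd (hx.trans (hmono hxb.le)) (not_le.2 hb)
  refine ⟨fun h => ?_, fun h => csInf_le hbdd h⟩
  refine le_trans ?_ (hmono h)
  set a := genInv (fun z => σ.real (Set.Iic z)) t with ha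
  have hr : Tendsto (fun x : ℝ => σ.real (Set.Iic x)) (𝓝[>] a) (𝓝 (σ.real (Set.Iic a))) := by
    have h0 := tendsto_measure_biInter_gt (μ := σ) (s := fun x : ℝ => Set.Iic x) (a := a)
      (fun r _ => measurableSet_Iic.nullMeasurableSet) (fun i j _ hij => Set.Iic_subset_Iic.2 hij)
      ⟨a + 1, by simp, measure_ne_top _ _⟩
    have h2 : (⋂ r > a, Set.Iic r) = Set.Iic a := by
      ext z
      simp only [Set.mem_iInter, Set.mem_Iic]
      exact ⟨fun h => le_of_forall_gt_imp_ge_of_dense h, fun h r hr => h.trans hr.le⟩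
    rw [h2] at h0
    exact (ENNReal.tendsto_toReal (measure_ne_top _ _)).comp h0
  refine ge_of_tendsto hr ?_
  filter_upwards [self_mem_nhdsWithin] with r hr
  obtain ⟨s, hs, hsr⟩ := exists_lt_of_csInf_lt hne (show sInf _ < r from hr)
  exact le_trans hs (hmono hsr.le)

lemma quantileFun_le_iff {σ : Measure ℝ} {t : ℝ} (ht : t ∈ Set.Ioo 0 (σ.real Set.univ)) (y : ℝ) :
    quantileFun σ t ≤ y ↔ t ≤ σ.real (Set.Iic y) := by
  rw [quantileFun, Set.indicator_of_mem ht, genInv_le_iff σ ht]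

lemma quantileFun_monotoneOn (σ : Measure ℝ) :
    MonotoneOn (quantileFun σ) (Set.Ioo 0 (σ.real Set.univ)) := fun _ ha _ hb hab =>
  (quantileFun_le_iff ha _).2 (hab.trans ((quantileFun_le_iff hb _).1 le_rfl))

lemma measurable_quantileFun {C : Type*} [MeasurableSpace C] (κ : Kernel C ℝ) :
    Measurable fun z : C × ℝ => quantileFun (κ z.1) z.2 := by
  have hm : ∀ s : Set ℝ, MeasurableSet s → Measurable fun z : C × ℝ => (κ z.1).real s :=
    fun s hs => ((κ.measurable_coe hs).comp measurable_fst).ennreal_toReal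
  have hI : MeasurableSet {z : C × ℝ | z.2 ∈ Set.Ioo 0 ((κ z.1).real Set.univ)} :=
    (measurableSet_lt measurable_const measurable_snd).inter
      (measurableSet_lt measurable_snd (hm _ .univ))
  refine measurable_of_Iic fun y => ?_
  have : (fun z : C × ℝ => quantileFun (κ z.1) z.2) ⁻¹' Set.Iic y =
      ({z : C × ℝ | z.2 ∈ Set.Ioo 0 ((κ z.1).real Set.univ)} ∩
        {z | z.2 ≤ (κ z.1).real (Set.Iic y)}) ∪
      ({z : C × ℝ | z.2 ∈ Set.Ioo 0 ((κ z.1).real Set.univ)}ᶜ ∩ {_z | 0 ≤ y}) := by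
    ext z
    by_cases hz : z.2 ∈ Set.Ioo 0 ((κ z.1).real Set.univ)
    · have := quantileFun_le_iff hz y
      simp_all
    · have : quantileFun (κ z.1) z.2 = 0 := Set.indicator_of_notMem hz _
      simp_all
  rw [this]
  exact (hI.inter (measurableSet_le measurable_snd (hm _ measurableSet_Iic))).union
    (hI.compl.inter (.const _))

lemma measurable_quantileFun_apply (σ : Measure ℝ) : Measurable (quantileFun σ) :=
  (measurable_quantileFun (Kernel.const Unit σ)).comp (measurable_prodMk_left (x := ()))

/-- The quantile function transports Lebesgue measure to the measure. -/
lemma map_quantileFun (σ : Measure ℝ) [IsFiniteMeasure σ] :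
    (volume.restrict (Set.Ioo 0 (σ.real Set.univ))).map (quantileFun σ) = σ := by
  refine (Measure.ext_of_Iic _ _ fun y => ?_).symm
  rw [Measure.map_apply (measurable_quantileFun_apply σ) measurableSet_Iic,
    Measure.restrict_apply (measurable_quantileFun_apply σ measurableSet_Iic)]
  have h1 : quantileFun σ ⁻¹' Set.Iic y ∩ Set.Ioo 0 (σ.real Set.univ) =
      Set.Iic (σ.real (Set.Iic y)) ∩ Set.Ioo 0 (σ.real Set.univ) := by
    ext t
    simp only [Set.mem_inter_iff, Set.mem_preimage, Set.mem_Iic, and_congr_left_iff]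
    exact fun ht => quantileFun_le_iff ht y
  have h2 : σ.real (Set.Iic y) ≤ σ.real Set.univ := measureReal_mono (Set.subset_univ _)
  -- Closing the right endpoint changes a null set and gives one interval formula, also when `σ (Iic
  -- y)` is the full mass.
  rw [h1, measure_congr ((ae_eq_refl _).inter Ioo_ae_eq_Ioc), Set.inter_comm, Set.Ioc_inter_Iic,
    inf_eq_right.2 h2, Real.volume_Ioc, sub_zero, ofReal_measureReal]

/-- Lebesgue measure on the unit interval. -/
abbrev unitLebesgue : Measure ℝ := volume.restrict (Set.Ioo 0 1)

instance : IsProbabilityMeasure unitLebesgue := ⟨by simp⟩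

lemma map_quantileFun_prob (σ : Measure ℝ) [IsProbabilityMeasure σ] :
    unitLebesgue.map (quantileFun σ) = σ := by
  simpa using map_quantileFun σ

lemma quantileFun_eq_genInv_cdf (σ : Measure ℝ) [IsProbabilityMeasure σ] {t : ℝ}
    (ht : t ∈ Set.Ioo (0 : ℝ) 1) : quantileFun σ t = genInv (cdf σ) t := by
  have : (cdf σ : ℝ → ℝ) = fun y => σ.real (Set.Iic y) := funext fun y => cdf_eq_real σ y
  rw [quantileFun, Set.indicator_of_mem (by simpa using ht), this]

lemma integral_comp_quantileFun (σ : Measure ℝ) [IsProbabilityMeasure σ] {f : ℝ → ℝ}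
    (hf : Measurable f) : ∫ u, f (quantileFun σ u) ∂unitLebesgue = ∫ y, f y ∂σ := by
  conv_rhs => rw [← map_quantileFun_prob σ]
  rw [integral_map (measurable_quantileFun_apply σ).aemeasurable hf.aestronglyMeasurable]

lemma integrable_quantileFun (σ : Measure ℝ) [IsProbabilityMeasure σ]
    (h : Integrable (fun y => y) σ) : Integrable (quantileFun σ) unitLebesgue := by
  have h1 : Integrable id (unitLebesgue.map (quantileFun σ)) := by
    rw [map_quantileFun_prob σ]; exact h
  exact h1.comp_measurable (measurable_quantileFun_apply σ)

/-! ### Tail integrals and stop-loss transforms of monotone functions -/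

lemma exists_threshold {ξ : ℝ → ℝ} (hξ : MonotoneOn ξ (Set.Ioo 0 1)) (t : ℝ) :
    ∃ a ∈ Set.Icc (0 : ℝ) 1, ∀ u ∈ Set.Ioo (0 : ℝ) 1, (a < u → t < ξ u) ∧ (u < a → ξ u ≤ t) := by
  -- Inserting `1` keeps the set nonempty when `ξ` never exceeds `t`; the threshold is then `1`.
  set S : Set ℝ := insert 1 {u | u ∈ Set.Ioo (0 : ℝ) 1 ∧ t < ξ u}
  have hbdd : ∀ s ∈ S, 0 ≤ s := by
    rintro s (rfl | hs)
    · exact zero_le_one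
    · exact hs.1.1.le
  have hne : S.Nonempty := ⟨1, Set.mem_insert _ _⟩
  refine ⟨sInf S, ⟨le_csInf hne hbdd, csInf_le ⟨0, hbdd⟩ (Set.mem_insert _ _)⟩,
    fun u hu => ⟨fun h => ?_, fun h => ?_⟩⟩
  · obtain ⟨s, hs, hsu⟩ := exists_lt_of_csInf_lt hne h
    rcases hs with rfl | hs
    · exact absurd hsu (not_lt.2 hu.2.le)
    · exact hs.2.trans_le (hξ hs.1 hu hsu.le)
  · by_contra! h'
    exact absurd (csInf_le ⟨0, hbdd⟩ (Set.mem_insert_of_mem _ ⟨hu, h'⟩)) (not_le.2 h)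

lemma integral_tail_sub {ξ : ℝ → ℝ} (hξ : Integrable ξ unitLebesgue) {a : ℝ}
    (ha : a ∈ Set.Icc (0 : ℝ) 1) (t : ℝ) :
    ∫ u, (Set.Ioo a 1).indicator (fun u => ξ u - t) u ∂unitLebesgue
      = (∫ u in a..1, ξ u) - (1 - a) * t := by
  have hsub : Set.Ioo a 1 ⊆ Set.Ioo 0 1 := Set.Ioo_subset_Ioo_left ha.1
  rw [integral_indicator measurableSet_Ioo, Measure.restrict_restrict measurableSet_Ioo,
    Set.inter_eq_left.2 hsub, integral_sub (IntegrableOn.mono_set hξ hsub) (by simp),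
    intervalIntegral.integral_of_le ha.2, integral_Ioc_eq_integral_Ioo]
  simp [ha.2]

lemma ae_ne_unitLebesgue (a : ℝ) : ∀ᵐ u ∂unitLebesgue, u ∈ Set.Ioo (0 : ℝ) 1 ∧ u ≠ a :=
  (ae_restrict_mem measurableSet_Ioo).and (ae_restrict_of_ae (by simp [ae_iff]))

lemma integrable_posPart_sub {α : Type*} [MeasurableSpace α] {μ : Measure α} [IsFiniteMeasure μ]
    {ξ : α → ℝ} (hξ : Integrable ξ μ) (t : ℝ) : Integrable (fun u => max (ξ u - t) 0) μ :=
  (hξ.sub (integrable_const t)).pos_part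

lemma integral_tail_le_posPart {ξ : ℝ → ℝ} (hξ : Integrable ξ unitLebesgue) {a : ℝ}
    (ha : a ∈ Set.Icc (0 : ℝ) 1) (t : ℝ) :
    (∫ u in a..1, ξ u) - (1 - a) * t ≤ ∫ u, max (ξ u - t) 0 ∂unitLebesgue := by
  rw [← integral_tail_sub hξ ha]
  refine integral_mono ((hξ.sub (integrable_const t)).indicator measurableSet_Ioo)
    (integrable_posPart_sub hξ t) fun u => ?_
  by_cases hu : u ∈ Set.Ioo a 1 <;> simp [hu]

/-- Equality case of the preceding bound: when `t` is a quantile of level `a`, the tail interval is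
where `ξ - t` is nonnegative, up to ties and the null point `a`. -/
lemma integral_tail_eq_posPart {ξ : ℝ → ℝ} (hξ : Integrable ξ unitLebesgue) {a : ℝ}
    (ha : a ∈ Set.Icc (0 : ℝ) 1) {t : ℝ}
    (h : ∀ u ∈ Set.Ioo (0 : ℝ) 1, (a < u → t ≤ ξ u) ∧ (u < a → ξ u ≤ t)) :
    (∫ u in a..1, ξ u) - (1 - a) * t = ∫ u, max (ξ u - t) 0 ∂unitLebesgue := by
  rw [← integral_tail_sub hξ ha]
  refine integral_congr_ae ?_
  filter_upwards [ae_ne_unitLebesgue a] with u ⟨hu, hne⟩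
  rcases lt_or_gt_of_ne hne with hlt | hlt
  · rw [Set.indicator_of_notMem (s := Set.Ioo a 1) (fun h => absurd h.1 (not_lt.2 hlt.le)), max_eq_right]
    simpa using (h u hu).2 hlt
  · rw [Set.indicator_of_mem (s := Set.Ioo a 1) ⟨hlt, hu.2⟩, max_eq_left]
    simpa using (h u hu).1 hlt

/-- For monotone functions with the same integral, domination of the tail integrals is domination
of the stop-loss transforms. -/
lemma tail_le_iff_posPart_le {ξ η : ℝ → ℝ} (hξm : MonotoneOn ξ (Set.Ioo 0 1))
    (hηm : MonotoneOn η (Set.Ioo 0 1)) (hξ : Integrable ξ unitLebesgue)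
    (hη : Integrable η unitLebesgue)
    (heq : ∫ u, ξ u ∂unitLebesgue = ∫ u, η u ∂unitLebesgue) :
    (∀ a ∈ Set.Ioo (0 : ℝ) 1, ∫ u in a..1, ξ u ≤ ∫ u in a..1, η u) ↔
      ∀ t, ∫ u, max (ξ u - t) 0 ∂unitLebesgue ≤ ∫ u, max (η u - t) 0 ∂unitLebesgue := by
  constructor
  · intro h t
    -- The level is optimal for `ξ`, giving equality there; for `η` the inequality valid at every
    -- level suffices. The endpoints `0` and `1`, outside the hypothesis, follow from equal
    -- integrals and from an empty interval.
    obtain ⟨a, ha, hat⟩ := exists_threshold hξm t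
    have htail : ∫ u in a..1, ξ u ≤ ∫ u in a..1, η u := by
      rcases eq_or_lt_of_le ha.1 with rfl | h0
      · simp only [intervalIntegral.integral_of_le zero_le_one, integral_Ioc_eq_integral_Ioo]
        exact heq.le
      rcases eq_or_lt_of_le ha.2 with rfl | h1
      · simp
      exact h a ⟨h0, h1⟩
    rw [← integral_tail_eq_posPart hξ ha fun u hu => ⟨fun h => ((hat u hu).1 h).le, (hat u hu).2⟩]
    exact le_trans (by linarith) (integral_tail_le_posPart hη ha t)
  · intro h a ha
    -- Now the threshold `η a` is optimal for `η`.
    have h1 := integral_tail_le_posPart hξ (Set.Ioo_subset_Icc_self ha) (η a)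
    have h2 := integral_tail_eq_posPart hη (Set.Ioo_subset_Icc_self ha) (t := η a)
      fun u hu => ⟨fun h => hηm ha hu h.le, fun h => hηm hu ha h.le⟩
    have := h (η a)
    linarith

/-! ### Monotone couplings of kernels -/

section MonotoneCoupling

variable {C : Type*} [MeasurableSpace C]

/-- Fibrewise `map_quantileFun`, assembled by Tonelli. The fibres may have different masses, so
levels range over the region under the graph of `mass`; a separate `mass` lets two kernels share
that region. -/
lemma map_quantileFun_region {μ : Measure C} [SFinite μ] {mass : C → ℝ}
    (hmass : Measurable mass) (σ : Kernel C ℝ) [IsSFiniteKernel σ]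
    (hσ : ∀ᵐ x ∂μ, IsFiniteMeasure (σ x) ∧ (σ x).real Set.univ = mass x) :
    ((μ.prod volume).restrict {z : C × ℝ | z.2 ∈ Set.Ioo 0 (mass z.1)}).map
      (fun z => (z.1, quantileFun (σ z.1) z.2)) = μ ⊗ₘ σ := by
  have hq := measurable_quantileFun σ
  have hI : MeasurableSet {z : C × ℝ | z.2 ∈ Set.Ioo 0 (mass z.1)} :=
    (measurableSet_lt measurable_const measurable_snd).inter
      (measurableSet_lt measurable_snd (hmass.comp measurable_fst))
  refine Measure.ext_of_lintegral _ fun f hf => ?_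
  rw [lintegral_map hf (by fun_prop), ← lintegral_indicator hI,
    lintegral_prod _ (Measurable.aemeasurable (by
      exact Measurable.indicator (hf.comp (measurable_fst.prodMk hq)) hI)),
    Measure.lintegral_compProd hf]
  refine lintegral_congr_ae ?_
  filter_upwards [hσ] with x ⟨hfin, hx⟩
  have hfx : Measurable fun y => f (x, y) := hf.comp measurable_prodMk_left
  conv_rhs => rw [← map_quantileFun (σ x), hx,
    lintegral_map hfx (measurable_quantileFun_apply _), ← lintegral_indicator measurableSet_Ioo]
  rfl

/-- Two kernels with the same finite masses, the first of which puts more mass on every left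
half-line, have a coupling concentrated on `{u ≤ w}`. -/
lemma exists_monotone_coupling {μ : Measure C} [SFinite μ] (σ τ : Kernel C ℝ) [IsSFiniteKernel σ]
    [IsSFiniteKernel τ]
    (hfin : ∀ᵐ x ∂μ, IsFiniteMeasure (σ x) ∧ IsFiniteMeasure (τ x))
    (hmass : ∀ᵐ x ∂μ, σ x Set.univ = τ x Set.univ)
    (hle : ∀ᵐ x ∂μ, ∀ u, τ x (Set.Iic u) ≤ σ x (Set.Iic u)) :
    ∃ π : Measure (C × ℝ × ℝ), π.map (fun z => (z.1, z.2.1)) = μ ⊗ₘ σ ∧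
      π.map (fun z => (z.1, z.2.2)) = μ ⊗ₘ τ ∧ ∀ᵐ z ∂π, z.2.1 ≤ z.2.2 := by
  have hσq := measurable_quantileFun σ
  have hτq := measurable_quantileFun τ
  set mass : C → ℝ := fun x => (σ x).real Set.univ with hmassdef
  have hm : Measurable mass := (σ.measurable_coe .univ).ennreal_toReal
  have hI : MeasurableSet {z : C × ℝ | z.2 ∈ Set.Ioo 0 (mass z.1)} :=
    (measurableSet_lt measurable_const measurable_snd).inter
      (measurableSet_lt measurable_snd (hm.comp measurable_fst))
  -- Both quantile functions receive the same level, so the coupling is comonotone in each fibre.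
  refine ⟨((μ.prod volume).restrict {z : C × ℝ | z.2 ∈ Set.Ioo 0 (mass z.1)}).map
    fun z => (z.1, quantileFun (σ z.1) z.2, quantileFun (τ z.1) z.2), ?_, ?_, ?_⟩
  · rw [Measure.map_map (by fun_prop) (by fun_prop)]
    refine map_quantileFun_region hm σ ?_
    filter_upwards [hfin] with x hx using ⟨hx.1, rfl⟩
  · rw [Measure.map_map (by fun_prop) (by fun_prop)]
    refine map_quantileFun_region hm τ ?_
    filter_upwards [hfin, hmass] with x hx hx' using
      ⟨hx.2, by simp only [hmassdef, measureReal_def, hx']⟩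
  · rw [ae_map_iff (p := fun z : C × ℝ × ℝ => z.2.1 ≤ z.2.2) (Measurable.aemeasurable (by fun_prop))
        (measurableSet_le (by fun_prop) (by fun_prop)),
      ae_restrict_iff' hI]
    have h1 : ∀ᵐ z ∂(μ.prod (volume : Measure ℝ)), (IsFiniteMeasure (σ z.1) ∧
        σ z.1 Set.univ = τ z.1 Set.univ ∧ ∀ u, τ z.1 (Set.Iic u) ≤ σ z.1 (Set.Iic u)) := by
      have h := (hfin.and (hmass.and hle)).mono fun x h => And.intro h.1.1 h.2
      exact (Measure.quasiMeasurePreserving_fst (ν := (volume : Measure ℝ))).ae h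
    filter_upwards [h1] with z ⟨h1, h2, h3⟩ hz
    have hz' : z.2 ∈ Set.Ioo 0 ((τ z.1).real Set.univ) := by
      simpa only [hmassdef, measureReal_def, h2] using hz
    rw [quantileFun_le_iff hz]
    refine ((quantileFun_le_iff hz' _).1 le_rfl).trans ?_
    exact ENNReal.toReal_mono (measure_ne_top _ _) (h3 _)

end MonotoneCoupling

/-! ### Martingale couplings from nested tail integrals -/

section SwapCoupling

variable {A : Type*} [MeasurableSpace A]

/-- The marginal of `π` has density `r⁺`, and weighting by at most `1 / r` brings it below one. This
ensures that the exchange never uses more mass than `m` has. -/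
lemma map_withDensity_le_restrict {B : Type*} [MeasurableSpace B] {m : Measure A} {π : Measure B}
    {f : B → A} (hf : Measurable f) {r : A → ℝ} (hr : Measurable r)
    (hπ : π.map f = m.withDensity fun a => ENNReal.ofReal (r a)) {c : B → ENNReal}
    (hc : ∀ᵐ z ∂π, c z ≤ (ENNReal.ofReal (r (f z)))⁻¹) :
    (π.withDensity c).map f ≤ m.restrict {a | 0 < r a} := by
  have hU : MeasurableSet {a | 0 < r a} := measurableSet_lt measurable_const hr
  refine Measure.le_intro fun s hs _ => ?_
  rw [Measure.map_apply hf hs, withDensity_apply _ (hf hs)]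
  calc ∫⁻ z in f ⁻¹' s, c z ∂π ≤ ∫⁻ z in f ⁻¹' s, (ENNReal.ofReal (r (f z)))⁻¹ ∂π :=
        lintegral_mono_ae (ae_restrict_of_ae hc)
    _ = ∫⁻ a in s, (ENNReal.ofReal (r a))⁻¹ ∂(π.map f) := by
        rw [setLIntegral_map hs (by fun_prop) hf]
    _ = ∫⁻ a in s, ENNReal.ofReal (r a) * (ENNReal.ofReal (r a))⁻¹ ∂m := by
        rw [hπ, restrict_withDensity hs, lintegral_withDensity_eq_lintegral_mul _
          (by fun_prop) (by fun_prop)]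
        rfl
    _ ≤ ∫⁻ a in s, {a | 0 < r a}.indicator 1 a ∂m := by
        refine lintegral_mono fun a => ?_
        by_cases ha : 0 < r a
        · simp [ha, ENNReal.mul_inv_le_one]
        · simp [ENNReal.ofReal_of_nonpos (not_lt.1 ha)]
    _ = m.restrict {a | 0 < r a} s := by
        rw [lintegral_indicator_one hU, Measure.restrict_apply hU, Measure.restrict_apply hs,
          Set.inter_comm]

/-- Let `π` couple the positive and negative parts of `(ξ - η) m`, with `ξ u ≤ ξ w` for `π`-almost
all `(u, w)`. Exchanging mass between `u` and `w` at rate `π / (η w - η u)` and leaving the rest of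
`m` on the diagonal gives a self-coupling of `m` under which `η` of the second variable has
conditional mean `ξ` of the first. -/
lemma exists_swap_coupling (m : Measure A) [IsFiniteMeasure m]
    {ξ η : A → ℝ} (hξ : Measurable ξ) (hη : Measurable η) (hξi : Integrable ξ m)
    (hηi : Integrable η m) (π : Measure (A × A))
    (h1 : π.map Prod.fst = m.withDensity fun a => ENNReal.ofReal (ξ a - η a))
    (h2 : π.map Prod.snd = m.withDensity fun a => ENNReal.ofReal (η a - ξ a))
    (hle : ∀ᵐ z ∂π, ξ z.1 ≤ ξ z.2)
    {E : Set (A × A)} (hE : MeasurableSet E) (hEdiag : ∀ a, (a, a) ∈ E)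
    (hEswap : ∀ z ∈ E, z.swap ∈ E) (hπE : ∀ᵐ z ∂π, z ∈ E) :
    ∃ M : Measure (A × A), M.map Prod.fst = m ∧ M.map Prod.snd = m ∧ (∀ᵐ z ∂M, z ∈ E) ∧
      ∀ s, MeasurableSet s → ∫ z in Prod.fst ⁻¹' s, η z.2 ∂M = ∫ a in s, ξ a ∂m := by
  have hpos1 : ∀ᵐ z ∂π, η z.1 < ξ z.1 := by
    have : ∀ᵐ a ∂(π.map Prod.fst), η a < ξ a := by
      rw [h1, ae_withDensity_iff (by fun_prop)]
      refine ae_of_all _ fun a ha => ?_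
      simpa using ha
    exact ae_of_ae_map measurable_fst.aemeasurable this
  have hpos2 : ∀ᵐ z ∂π, ξ z.2 < η z.2 := by
    have : ∀ᵐ a ∂(π.map Prod.snd), ξ a < η a := by
      rw [h2, ae_withDensity_iff (by fun_prop)]
      refine ae_of_all _ fun a ha => ?_
      simpa using ha
    exact ae_of_ae_map measurable_snd.aemeasurable this
  set c : A × A → ENNReal := fun z => (ENNReal.ofReal (η z.2 - η z.1))⁻¹ with hcdef
  have hc : Measurable c := by fun_prop
  set π' := π.withDensity c with hπ'
  have hp1 : π'.map Prod.fst ≤ m.restrict {a | 0 < ξ a - η a} := by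
    -- From `ξ z.1 ≤ ξ z.2 < η z.2`, the gap `η z.2 - η z.1` is at least `ξ z.1 - η z.1`. The bound
    -- for the second marginal is symmetric, using `η z.1 < ξ z.1 ≤ ξ z.2`.
    refine map_withDensity_le_restrict measurable_fst (hξ.sub hη) h1 ?_
    filter_upwards [hle, hpos2] with z hz1 hz2
    exact ENNReal.inv_le_inv.2 (ENNReal.ofReal_le_ofReal (by simp; linarith))
  have hp2 : π'.map Prod.snd ≤ m.restrict {a | 0 < η a - ξ a} := by
    refine map_withDensity_le_restrict measurable_snd (hη.sub hξ) h2 ?_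
    filter_upwards [hle, hpos1] with z hz1 hz2
    exact ENNReal.inv_le_inv.2 (ENNReal.ofReal_le_ofReal (by simp; linarith))
  set p := π'.map Prod.fst + π'.map Prod.snd with hp
  have hpm : p ≤ m := by
    refine (add_le_add hp1 hp2).trans ?_
    -- The two marginals live on the disjoint sets `ξ > η` and `η > ξ`, so their sum still fits
    -- under `m`.
    rw [← Measure.restrict_union]
    · exact Measure.restrict_le_self
    · refine Set.disjoint_left.2 fun a ha hb => ?_
      simp only [Set.mem_ofPred_eq] at ha hb
      linarith
    · exact measurableSet_lt measurable_const (hη.sub hξ)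
  have hpfin : IsFiniteMeasure p := isFiniteMeasure_of_le m hpm
  have hdiag : Measurable fun a : A => (a, a) := by fun_prop
  set M := π' + π'.map Prod.swap + (m - p).map fun a => (a, a) with hM
  have hM1 : M.map Prod.fst = m := by
    rw [hM, Measure.map_add _ _ measurable_fst, Measure.map_add _ _ measurable_fst,
      Measure.map_map measurable_fst measurable_swap, Measure.map_map measurable_fst hdiag]
    have e1 : (Prod.fst ∘ Prod.swap : A × A → A) = Prod.snd := rfl
    have e2 : (Prod.fst ∘ fun a : A => (a, a)) = id := rfl
    rw [e1, e2, Measure.map_id, ← hp, add_comm, Measure.sub_add_cancel_of_le hpm]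
  have hM2 : M.map Prod.snd = m := by
    rw [hM, Measure.map_add _ _ measurable_snd, Measure.map_add _ _ measurable_snd,
      Measure.map_map measurable_snd measurable_swap, Measure.map_map measurable_snd hdiag]
    have e1 : (Prod.snd ∘ Prod.swap : A × A → A) = Prod.fst := rfl
    have e2 : (Prod.snd ∘ fun a : A => (a, a)) = id := rfl
    rw [e1, e2, Measure.map_id, add_comm (π'.map _) (π'.map _), ← hp, add_comm,
      Measure.sub_add_cancel_of_le hpm]
  refine ⟨M, hM1, hM2, ?_, fun s hs => ?_⟩
  · have h3 : ∀ᵐ z ∂π', z ∈ E := (withDensity_absolutelyContinuous π c).ae_le hπE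
    rw [hM, ae_add_measure_iff, ae_add_measure_iff,
      ae_map_iff (p := (· ∈ E)) measurable_swap.aemeasurable hE,
      ae_map_iff (p := (· ∈ E)) hdiag.aemeasurable hE]
    exact ⟨⟨h3, h3.mono hEswap⟩, ae_of_all _ hEdiag⟩
  · have hs1 : MeasurableSet (Prod.fst ⁻¹' s : Set (A × A)) := measurable_fst hs
    have hs2 : MeasurableSet (Prod.snd ⁻¹' s : Set (A × A)) := measurable_snd hs
    have hη1 : Integrable (fun z : A × A => η z.1) M := by
      rw [← hM1] at hηi; exact hηi.comp_measurable measurable_fst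
    have hη2 : Integrable (fun z : A × A => η z.2) M := by
      rw [← hM2] at hηi; exact hηi.comp_measurable measurable_snd
    -- Only the displacement `η z.2 - η z.1` matters: it vanishes on the diagonal, and elsewhere the
    -- rate cancels it and leaves `π`. The two directions of exchange contribute `(ξ - η)⁺` and `-(η
    -- - ξ)⁺`.
    have hsplit : ∫ z in Prod.fst ⁻¹' s, η z.2 ∂M =
        ∫ z in Prod.fst ⁻¹' s, (η z.2 - η z.1) ∂M + ∫ a in s, η a ∂m := by
      rw [integral_sub hη2.integrableOn hη1.integrableOn]
      conv_rhs => rw [← hM1]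
      rw [setIntegral_map hs hη.aestronglyMeasurable measurable_fst.aemeasurable]
      ring
    have hπfst : π (Prod.fst ⁻¹' s) = ∫⁻ a in s, ENNReal.ofReal (ξ a - η a) ∂m := by
      rw [← Measure.map_apply measurable_fst hs, h1, withDensity_apply _ hs]
    have hπsnd : π (Prod.snd ⁻¹' s) = ∫⁻ a in s, ENNReal.ofReal (-(ξ a - η a)) ∂m := by
      simp only [neg_sub]
      rw [← Measure.map_apply measurable_snd hs, h2, withDensity_apply _ hs]
    set F : A × A → ℝ := (Prod.fst ⁻¹' s).indicator fun z => η z.2 - η z.1 with hF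
    have hFm : Measurable F := by
      exact ((hη.comp measurable_snd).sub (hη.comp measurable_fst)).indicator hs1
    have hFi : Integrable F M := (hη2.sub hη1).indicator hs1
    have hFi' : Integrable F (π' + π'.map Prod.swap) :=
      hFi.mono_measure (Measure.le_add_right le_rfl)
    have hcfin : ∀ᵐ z ∂π, c z < ⊤ := by
      filter_upwards [hle, hpos1, hpos2] with z g1 g2 g3
      simp only [hcdef, ENNReal.inv_lt_top, ENNReal.ofReal_pos]
      linarith
    have hcmul : ∀ᵐ z ∂π, (c z).toReal * (η z.2 - η z.1) = 1 := by
      filter_upwards [hle, hpos1, hpos2] with z g1 g2 g3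
      have : 0 < η z.2 - η z.1 := by linarith
      simp only [hcdef, ENNReal.toReal_inv, ENNReal.toReal_ofReal this.le]
      exact inv_mul_cancel₀ this.ne'
    have hI1 : ∫ z, F z ∂π' = π.real (Prod.fst ⁻¹' s) := by
      rw [hπ', integral_withDensity_eq_integral_toReal_smul hc hcfin, ← integral_indicator_one hs1]
      refine integral_congr_ae ?_
      filter_upwards [hcmul] with z hz
      by_cases hzs : z ∈ (Prod.fst ⁻¹' s : Set (A × A)) <;> simp [hF, hzs, hz]
    have hI2 : ∫ z, F z ∂(π'.map Prod.swap) = -π.real (Prod.snd ⁻¹' s) := by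
      rw [integral_map measurable_swap.aemeasurable hFm.aestronglyMeasurable, hπ',
        integral_withDensity_eq_integral_toReal_smul hc hcfin, ← integral_indicator_one hs2,
        ← integral_neg]
      refine integral_congr_ae ?_
      filter_upwards [hcmul] with z hz
      by_cases hzs : z.2 ∈ s
      · have h1 : z.swap ∈ (Prod.fst ⁻¹' s : Set (A × A)) := hzs
        have h2 : z ∈ (Prod.snd ⁻¹' s : Set (A × A)) := hzs
        simp only [hF, Set.indicator_of_mem h1, Set.indicator_of_mem h2, Prod.fst_swap,
          Prod.snd_swap, smul_eq_mul, Pi.one_apply]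
        linarith
      · have h1 : z.swap ∉ (Prod.fst ⁻¹' s : Set (A × A)) := hzs
        have h2 : z ∉ (Prod.snd ⁻¹' s : Set (A × A)) := hzs
        simp [hF, Set.indicator_of_notMem h1, Set.indicator_of_notMem h2]
    have hI3 : ∫ z, F z ∂((m - p).map fun a => (a, a)) = 0 := by
      rw [integral_map hdiag.aemeasurable hFm.aestronglyMeasurable]
      refine integral_eq_zero_of_ae (ae_of_all _ fun a => ?_)
      by_cases has : a ∈ s <;> simp [hF, has]
    have hItot : ∫ z in Prod.fst ⁻¹' s, (η z.2 - η z.1) ∂M = ∫ a in s, (ξ a - η a) ∂m := by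
      rw [← integral_indicator hs1, ← hF]
      have : ∫ z, F z ∂M = ∫ z, F z ∂π' + ∫ z, F z ∂(π'.map Prod.swap)
          + ∫ z, F z ∂((m - p).map fun a => (a, a)) := by
        rw [hM, integral_add_measure hFi' (hFi.mono_measure (Measure.le_add_left le_rfl)),
          integral_add_measure (hFi'.mono_measure (Measure.le_add_right le_rfl))
            (hFi'.mono_measure (Measure.le_add_left le_rfl))]
      rw [this, hI1, hI2, hI3, integral_eq_lintegral_pos_part_sub_lintegral_neg_part
        (f := fun a => ξ a - η a) (hξi.sub hηi).integrableOn, ← hπfst, ← hπsnd]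
      simp [measureReal_def, sub_eq_add_neg]
    rw [hsplit, hItot, integral_sub hξi.integrableOn hηi.integrableOn]
    ring

end SwapCoupling

/-! ### Martingale couplings of kernels in the convex order -/

section MartingaleCoupling

/-- With total integral zero, the left part is minus the tail. For `f = ξ - η` this is the half-line
comparison of positive and negative parts that `exists_monotone_coupling` requires. -/
lemma integral_Iic_nonneg_of_tail_nonpos {f : ℝ → ℝ} (hf : Integrable f unitLebesgue)
    (h0 : ∫ u, f u ∂unitLebesgue = 0) (htail : ∀ a ∈ Set.Ioo (0 : ℝ) 1, ∫ u in a..1, f u ≤ 0)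
    (u : ℝ) : 0 ≤ ∫ v in Set.Iic u, f v ∂unitLebesgue := by
  have hadd := integral_add_compl (measurableSet_Iic (a := u)) hf
  rw [h0, Set.compl_Iic] at hadd
  rw [Measure.restrict_restrict measurableSet_Iic] at hadd ⊢
  rw [Measure.restrict_restrict measurableSet_Ioi] at hadd
  rcases le_or_gt u 0 with hu | hu
  · rw [Set.eq_empty_iff_forall_notMem.2 (fun z hz => ?_ : ∀ z, z ∉ Set.Iic u ∩ Set.Ioo 0 1)]
    · simp
    · exact absurd (hz.1.trans hu) (not_le.2 hz.2.1)
  rcases le_or_gt 1 u with hu1 | hu1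
  · have h2 : Set.Ioo 0 1 ⊆ Set.Iic u := fun z hz => hz.2.le.trans hu1
    rw [Set.inter_eq_right.2 h2]
    exact h0.ge
  have h1 := htail u ⟨hu, hu1⟩
  rw [intervalIntegral.integral_of_le hu1.le, integral_Ioc_eq_integral_Ioo] at h1
  have h2 : Set.Ioi u ∩ Set.Ioo 0 1 = Set.Ioo u 1 := by
    ext z
    simp only [Set.mem_inter_iff, Set.mem_Ioi, Set.mem_Ioo]
    exact ⟨fun h => ⟨h.1, h.2.2⟩, fun h => ⟨h.1, hu.trans h.1, h.2⟩⟩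
  rw [h2] at hadd
  linarith

variable {C : Type*} [MeasurableSpace C]

/-- The kernel of positive parts of `f x · Lebesgue` on the unit interval. -/
def posPartKernel (f : C × ℝ → ℝ) : Kernel C ℝ :=
  (Kernel.const C unitLebesgue).withDensity fun x u => ENNReal.ofReal (f (x, u))

instance (f : C × ℝ → ℝ) : IsSFiniteKernel (posPartKernel f) :=
  Kernel.IsSFiniteKernel.withDensity _ fun _ _ => ENNReal.ofReal_ne_top

lemma posPartKernel_apply {f : C × ℝ → ℝ} (hf : Measurable f) (x : C) (s : Set ℝ) :
    posPartKernel f x s = ∫⁻ u in s, ENNReal.ofReal (f (x, u)) ∂unitLebesgue := by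
  rw [posPartKernel, Kernel.withDensity_apply' _ (by
    exact ENNReal.measurable_ofReal.comp hf), Kernel.const_apply]

lemma compProd_posPartKernel (μ : Measure C) [SFinite μ] {f : C × ℝ → ℝ} (hf : Measurable f) :
    μ ⊗ₘ posPartKernel f =
      (μ.prod unitLebesgue).withDensity fun a => ENNReal.ofReal (f a) := by
  refine Measure.ext_of_lintegral _ fun g hg => ?_
  rw [Measure.lintegral_compProd hg, lintegral_withDensity_eq_lintegral_mul _ (by fun_prop) hg,
    lintegral_prod _ (by fun_prop)]
  refine lintegral_congr fun x => ?_
  have hgx : Measurable fun u => g (x, u) := hg.comp measurable_prodMk_left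
  rw [posPartKernel, Kernel.lintegral_withDensity _ (by
    exact ENNReal.measurable_ofReal.comp hf) _ hgx,
    Kernel.const_apply]
  rfl

/-- The swap coupling in all fibres at once: monotonicity of `ξ` turns the ordering `u ≤ w` of
coupled levels into `ξ u ≤ ξ w`. -/
lemma exists_martingale_coupling_unit [MeasurableEq C] (μ : Measure C) [IsFiniteMeasure μ] {ξ η : C × ℝ → ℝ}
    (hξ : Measurable ξ) (hη : Measurable η) (hξi : Integrable ξ (μ.prod unitLebesgue))
    (hηi : Integrable η (μ.prod unitLebesgue))
    (hmono : ∀ᵐ x ∂μ, MonotoneOn (fun u => ξ (x, u)) (Set.Ioo 0 1))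
    (heq : ∀ᵐ x ∂μ, ∫ u, ξ (x, u) ∂unitLebesgue = ∫ u, η (x, u) ∂unitLebesgue)
    (htail : ∀ᵐ x ∂μ, ∀ a ∈ Set.Ioo (0 : ℝ) 1,
      ∫ u in a..1, ξ (x, u) ≤ ∫ u in a..1, η (x, u)) :
    ∃ M : Measure ((C × ℝ) × (C × ℝ)), M.map Prod.fst = μ.prod unitLebesgue ∧
      M.map Prod.snd = μ.prod unitLebesgue ∧ (∀ᵐ z ∂M, z.1.1 = z.2.1) ∧
      ∀ s, MeasurableSet s →
        ∫ z in Prod.fst ⁻¹' s, η z.2 ∂M = ∫ a in s, ξ a ∂(μ.prod unitLebesgue) := by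
  have hd1 : Measurable fun a => ξ a - η a := hξ.sub hη
  have hd2 : Measurable fun a => η a - ξ a := hη.sub hξ
  have hfin : ∀ᵐ x ∂μ, IsFiniteMeasure (posPartKernel (fun a => ξ a - η a) x) ∧
      IsFiniteMeasure (posPartKernel (fun a => η a - ξ a) x) := by
    filter_upwards [hξi.prod_right_ae, hηi.prod_right_ae] with x h1 h2
    refine ⟨⟨?_⟩, ⟨?_⟩⟩
    · rw [posPartKernel_apply hd1 x, setLIntegral_univ]
      exact (h1.sub h2).lintegral_lt_top
    · rw [posPartKernel_apply hd2 x, setLIntegral_univ]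
      exact (h2.sub h1).lintegral_lt_top
  have hdiff : ∀ᵐ x ∂μ, ∀ s, ∫ u in s, (ξ (x, u) - η (x, u)) ∂unitLebesgue =
      (posPartKernel (fun a => ξ a - η a) x s).toReal
        - (posPartKernel (fun a => η a - ξ a) x s).toReal := by
    filter_upwards [hξi.prod_right_ae, hηi.prod_right_ae] with x h1 h2 s
    rw [posPartKernel_apply hd1 x, posPartKernel_apply hd2 x,
      integral_eq_lintegral_pos_part_sub_lintegral_neg_part
        (f := fun u => ξ (x, u) - η (x, u)) (h1.sub h2).integrableOn]
    simp only [neg_sub]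
  obtain ⟨π, hπ1, hπ2, hπle⟩ := exists_monotone_coupling (μ := μ)
    (posPartKernel fun a => ξ a - η a) (posPartKernel fun a => η a - ξ a) hfin (by
      filter_upwards [hξi.prod_right_ae, hηi.prod_right_ae, hfin, hdiff, heq]
        with x h1 h2 ⟨h3, h4⟩ h5 h6
      have := h5 Set.univ
      rw [setIntegral_univ, integral_sub h1 h2, h6, sub_self] at this
      rw [← ENNReal.toReal_eq_toReal_iff' (measure_ne_top _ _) (measure_ne_top _ _)]
      linarith) (by
      filter_upwards [hξi.prod_right_ae, hηi.prod_right_ae, hfin, hdiff, heq, htail]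
        with x h1 h2 ⟨h3, h4⟩ h5 h6 h7 u
      have := h5 (Set.Iic u)
      have hnn := integral_Iic_nonneg_of_tail_nonpos (h1.sub h2)
        (by simp only [Pi.sub_apply]; rw [integral_sub h1 h2, h6, sub_self]) (fun a ha => by
          have hi : ∀ {g : ℝ → ℝ}, Integrable g unitLebesgue →
              IntervalIntegrable g volume a 1 := fun hg => by
            rw [intervalIntegrable_iff_integrableOn_Ioo_of_le ha.2.le]
            exact IntegrableOn.mono_set hg (Set.Ioo_subset_Ioo_left ha.1.le)
          simp only [Pi.sub_apply]
          rw [intervalIntegral.integral_sub (hi h1) (hi h2)]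
          linarith [h7 a ha]) u
      simp only [Pi.sub_apply] at hnn
      rw [← ENNReal.toReal_le_toReal (measure_ne_top _ _) (measure_ne_top _ _)]
      linarith)
  rw [compProd_posPartKernel μ hd1] at hπ1
  rw [compProd_posPartKernel μ hd2] at hπ2
  have hgood : ∀ᵐ a ∂(μ.prod unitLebesgue),
      MonotoneOn (fun u => ξ (a.1, u)) (Set.Ioo 0 1) ∧ a.2 ∈ Set.Ioo (0 : ℝ) 1 :=
    (Measure.quasiMeasurePreserving_fst.ae hmono).and
      (Measure.quasiMeasurePreserving_snd.ae (ae_restrict_mem measurableSet_Ioo))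
  have hg1 : ∀ᵐ z ∂π, MonotoneOn (fun u => ξ (z.1, u)) (Set.Ioo 0 1) ∧
      z.2.1 ∈ Set.Ioo (0 : ℝ) 1 := by
    refine ae_of_ae_map (f := fun z : C × ℝ × ℝ => (z.1, z.2.1)) (p := fun a =>
      MonotoneOn (fun u => ξ (a.1, u)) (Set.Ioo 0 1) ∧ a.2 ∈ Set.Ioo (0 : ℝ) 1) (by fun_prop) ?_
    rw [hπ1]
    exact (withDensity_absolutelyContinuous _ _).ae_le hgood
  have hg2 : ∀ᵐ z ∂π, z.2.2 ∈ Set.Ioo (0 : ℝ) 1 := by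
    refine ae_of_ae_map (f := fun z : C × ℝ × ℝ => (z.1, z.2.2)) (p := fun a =>
      a.2 ∈ Set.Ioo (0 : ℝ) 1) (by fun_prop) ?_
    rw [hπ2]
    exact (withDensity_absolutelyContinuous _ _).ae_le (hgood.mono fun _ h => h.2)
  have hJ : Measurable fun z : C × ℝ × ℝ => ((z.1, z.2.1), (z.1, z.2.2)) := by fun_prop
  have hE : MeasurableSet {z : (C × ℝ) × (C × ℝ) | z.1.1 = z.2.1} :=
    measurableSet_eq_fun (by fun_prop) (by fun_prop)
  -- The set `E` of pairs with a common covariate contains the diagonal and is stable under swaps,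
  -- so the exchange stays within fibres.
  refine exists_swap_coupling (E := {z | z.1.1 = z.2.1}) (μ.prod unitLebesgue) hξ hη hξi hηi
    (π.map fun z => ((z.1, z.2.1), (z.1, z.2.2))) ?_ ?_ ?_ hE (fun _ => rfl)
    (fun _ h => Eq.symm h) ?_
  · rw [Measure.map_map measurable_fst hJ]
    exact hπ1
  · rw [Measure.map_map measurable_snd hJ]
    exact hπ2
  · rw [ae_map_iff (p := fun z : (C × ℝ) × (C × ℝ) => ξ z.1 ≤ ξ z.2) hJ.aemeasurable
      (measurableSet_le (by fun_prop) (by fun_prop))]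
    filter_upwards [hg1, hg2, hπle] with z h1 h2 h3 using h1.1 h1.2 h2 h3
  · rw [ae_map_iff (p := (· ∈ {z : (C × ℝ) × (C × ℝ) | z.1.1 = z.2.1})) hJ.aemeasurable hE]
    exact ae_of_all _ fun _ => rfl

lemma map_quantileFun_prod (μ : Measure C) [SFinite μ] (κ : Kernel C ℝ) [IsMarkovKernel κ] :
    (μ.prod unitLebesgue).map (fun a => (a.1, quantileFun (κ a.1) a.2)) = μ ⊗ₘ κ := by
  have := map_quantileFun_region (μ := μ) (mass := fun _ => 1) measurable_const κ
    (ae_of_all _ fun x => ⟨inferInstance, by simp⟩)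
  rw [← this]
  congr 1
  rw [← Measure.restrict_univ (μ := μ), Measure.prod_restrict, Measure.restrict_univ]
  congr 1
  ext z
  simp

/-- Strassen's theorem for kernels on the line: if `κ₁ x` is dominated by `κ₂ x` in the convex
order for almost every `x`, then there is a joint martingale coupling. -/
lemma exists_martingale_coupling [MeasurableEq C] (μ : Measure C) [IsFiniteMeasure μ] (κ₁ κ₂ : Kernel C ℝ)
    [IsMarkovKernel κ₁] [IsMarkovKernel κ₂] (h₁ : Integrable Prod.snd (μ ⊗ₘ κ₁))
    (h₂ : Integrable Prod.snd (μ ⊗ₘ κ₂))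
    (hmean : ∀ᵐ x ∂μ, ∫ y, y ∂(κ₁ x) = ∫ y, y ∂(κ₂ x))
    (hcx : ∀ᵐ x ∂μ, ∀ t, ∫ y, max (y - t) 0 ∂(κ₁ x) ≤ ∫ y, max (y - t) 0 ∂(κ₂ x)) :
    ∃ ρ : Measure (C × ℝ × ℝ), ρ.map (fun z => (z.1, z.2.1)) = μ ⊗ₘ κ₁ ∧
      ρ.map (fun z => (z.1, z.2.2)) = μ ⊗ₘ κ₂ ∧
      ∀ s, MeasurableSet s →
        ∫ z in (fun z : C × ℝ × ℝ => (z.1, z.2.1)) ⁻¹' s, (z.2.2) ∂ρ = ∫ a in s, a.2 ∂(μ ⊗ₘ κ₁) := by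
  have hξ := measurable_quantileFun κ₁
  have hη := measurable_quantileFun κ₂
  have hξ' : Measurable fun a : C × ℝ => (a.1, quantileFun (κ₁ a.1) a.2) := by fun_prop
  have hη' : Measurable fun a : C × ℝ => (a.1, quantileFun (κ₂ a.1) a.2) := by fun_prop
  have hi₁ : ∀ᵐ x ∂μ, Integrable (fun y => y) (κ₁ x) := ((Measure.integrable_compProd_iff
    h₁.aestronglyMeasurable).1 h₁).1
  have hi₂ : ∀ᵐ x ∂μ, Integrable (fun y => y) (κ₂ x) := ((Measure.integrable_compProd_iff
    h₂.aestronglyMeasurable).1 h₂).1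
  have heq : ∀ᵐ x ∂μ, ∫ u, quantileFun (κ₁ x) u ∂unitLebesgue =
      ∫ u, quantileFun (κ₂ x) u ∂unitLebesgue := by
    filter_upwards [hmean] with x hx
    rw [integral_comp_quantileFun _ (f := fun y => y) measurable_id,
      integral_comp_quantileFun _ (f := fun y => y) measurable_id, hx]
  have hmono : ∀ (κ : Kernel C ℝ) [IsMarkovKernel κ] x,
      MonotoneOn (quantileFun (κ x)) (Set.Ioo 0 1) := fun κ _ x => by
    simpa using quantileFun_monotoneOn (κ x)
  obtain ⟨M, hM1, hM2, hME, hM⟩ := exists_martingale_coupling_unit μ hξ hη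
    (by rw [← map_quantileFun_prod μ κ₁] at h₁; exact h₁.comp_measurable hξ')
    (by rw [← map_quantileFun_prod μ κ₂] at h₂; exact h₂.comp_measurable hη')
    (ae_of_all _ fun x => hmono κ₁ x) heq (by
      filter_upwards [hcx, heq, hi₁, hi₂] with x h1 h2 h3 h4
      rw [tail_le_iff_posPart_le (hmono κ₁ x) (hmono κ₂ x) (integrable_quantileFun _ h3)
        (integrable_quantileFun _ h4) h2]
      intro t
      rw [integral_comp_quantileFun _ (f := fun y => max (y - t) 0) (by fun_prop),
        integral_comp_quantileFun _ (f := fun y => max (y - t) 0) (by fun_prop)]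
      exact h1 t)
  have hJ : Measurable fun z : (C × ℝ) × (C × ℝ) =>
    (z.1.1, quantileFun (κ₁ z.1.1) z.1.2, quantileFun (κ₂ z.2.1) z.2.2) :=
    (measurable_fst.comp measurable_fst).prodMk
      ((hξ.comp measurable_fst).prodMk (hη.comp measurable_snd))
  refine ⟨M.map fun z => (z.1.1, quantileFun (κ₁ z.1.1) z.1.2, quantileFun (κ₂ z.2.1) z.2.2),
    ?_, ?_, fun s hs => ?_⟩
  · rw [Measure.map_map (by fun_prop) hJ, ← map_quantileFun_prod μ κ₁, ← hM1,
      Measure.map_map hξ' measurable_fst]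
    rfl
  · rw [Measure.map_map (by fun_prop) hJ, ← map_quantileFun_prod μ κ₂, ← hM2,
      Measure.map_map hη' measurable_snd]
    refine Measure.map_congr ?_
    filter_upwards [hME] with z hz
    simp [hz]
  · have hp : Measurable fun z : C × ℝ × ℝ => (z.1, z.2.1) := by fun_prop
    rw [setIntegral_map (hp hs)
      (f := fun z : C × ℝ × ℝ => z.2.2) (measurable_snd.comp measurable_snd).aestronglyMeasurable
      hJ.aemeasurable, ← map_quantileFun_prod μ κ₁,
      setIntegral_map hs measurable_snd.aestronglyMeasurable hξ'.aemeasurable]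
    -- Conditioning on the value is coarser than conditioning on the level, so this preimage is
    -- among the sets already tested.
    exact hM _ (hξ' hs)

end MartingaleCoupling

/-! ### Gluing -/

lemma integrable_integral_compProd {A B : Type*} [MeasurableSpace A] [MeasurableSpace B]
    {μ : Measure A} [SFinite μ] {κ : Kernel A B} [IsSFiniteKernel κ] {f : A × B → ℝ}
    (hf : Integrable f (μ ⊗ₘ κ)) : Integrable (fun x => ∫ y, f (x, y) ∂κ x) μ := by
  have := Integrable.integral_compProd (κ := Kernel.const Unit μ)
    (η := Kernel.prodMkLeft Unit κ) (a := ()) hf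
  simpa using this

/-- If the conditional mean under `ρ` of the second variable given `b` is `ψ b`, and `φ` transports
`P` to the first marginal of `ρ`, then the second variable can be coupled to `P` with conditional
mean `ψ ∘ φ`. -/
lemma exists_glue {A B : Type*} [MeasurableSpace A] [MeasurableSpace B] (P : Measure A)
    [IsFiniteMeasure P] {φ : A → B} (hφ : Measurable φ) (ρ : Measure (B × ℝ)) [IsFiniteMeasure ρ]
    (hρ : ρ.fst = P.map φ) (hi : Integrable Prod.snd ρ) {ψ : B → ℝ} (hψi : Integrable ψ ρ.fst)
    (hmean : ∀ s, MeasurableSet s → ∫ z in Prod.fst ⁻¹' s, z.2 ∂ρ = ∫ b in s, ψ b ∂ρ.fst) :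
    ∃ θ : Measure (A × ℝ), θ.fst = P ∧ θ.map (Prod.map φ id) = ρ ∧
      ∀ s, MeasurableSet s → ∫ z in Prod.fst ⁻¹' s, z.2 ∂θ = ∫ a in s, ψ (φ a) ∂P := by
  have hρi : Integrable Prod.snd (ρ.fst ⊗ₘ ρ.condKernel) := by rwa [ρ.disintegrate]
  have hmeani : Integrable (fun b => ∫ y, y ∂ρ.condKernel b) ρ.fst := integrable_integral_compProd hρi
  have hcond : (fun b => ∫ y, y ∂ρ.condKernel b) =ᵐ[ρ.fst] ψ := by
    refine Integrable.ae_eq_of_forall_setIntegral_eq _ _ hmeani hψi fun s hs _ => ?_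
    rw [← hmean s hs]
    conv_rhs => rw [← ρ.disintegrate ρ.condKernel]
    rw [← Set.prod_univ, Measure.setIntegral_compProd hs .univ hρi.integrableOn]
    simp
  -- The second variable is made to depend on `a` only through `φ a`.
  set L : Kernel A ℝ := ρ.condKernel.comap φ hφ with hL
  have hmap : (P ⊗ₘ L).map (Prod.map φ id) = ρ := by
    conv_rhs => rw [← ρ.disintegrate ρ.condKernel, hρ]
    refine Measure.ext_of_lintegral _ fun f hf => ?_
    rw [lintegral_map hf (by fun_prop), Measure.lintegral_compProd hf,
      lintegral_map hf.lintegral_kernel_prod_right' hφ, Measure.lintegral_compProd (by fun_prop)]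
    rfl
  have hi' : Integrable Prod.snd (P ⊗ₘ L) := by
    rw [← hmap] at hi
    exact hi.comp_measurable (hφ.prodMap measurable_id)
  refine ⟨P ⊗ₘ L, Measure.fst_compProd P L, hmap, fun s hs => ?_⟩
  rw [← Set.prod_univ, Measure.setIntegral_compProd hs .univ hi'.integrableOn]
  refine integral_congr_ae (ae_restrict_of_ae ?_)
  rw [hρ] at hcond
  filter_upwards [ae_of_ae_map hφ.aemeasurable hcond] with a ha
  simpa [hL] using ha

/-! ### Stop-loss transforms -/

section StopLoss

variable {Ω : Type*} [MeasurableSpace Ω] {P : Measure Ω}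

/-- The positive part is 1-Lipschitz. This bound yields continuity of stop-loss transforms in the
threshold and the slope, and controls recentering. -/
lemma abs_integral_posPart_sub_le {f g : Ω → ℝ} (hf : Integrable f P) (hg : Integrable g P) :
    |∫ ω, max (f ω) 0 ∂P - ∫ ω, max (g ω) 0 ∂P| ≤ ∫ ω, |f ω - g ω| ∂P := by
  rw [← integral_sub hf.pos_part hg.pos_part]
  refine abs_integral_le_integral_abs.trans
    (integral_mono (hf.pos_part.sub hg.pos_part).abs (hf.sub hg).abs fun ω => ?_)
  exact abs_max_sub_max_le_abs _ _ _

lemma continuous_integral_posPart [IsProbabilityMeasure P] {f : Ω → ℝ} (hf : Integrable f P) :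
    Continuous fun t => ∫ ω, max (f ω - t) 0 ∂P := by
  refine (LipschitzWith.of_dist_le_mul (K := 1) fun s t => ?_).continuous
  refine (abs_integral_posPart_sub_le (hf.sub (integrable_const s))
    (hf.sub (integrable_const t))).trans ?_
  simp [Real.dist_eq, abs_sub_comm]

lemma integral_abs_eq_posPart {f : Ω → ℝ} (hf : Integrable f P) :
    ∫ ω, |f ω| ∂P = 2 * ∫ ω, max (f ω) 0 ∂P - ∫ ω, f ω ∂P := by
  rw [← integral_const_mul, ← integral_sub (hf.pos_part.const_mul 2) hf]
  refine integral_congr_ae (ae_of_all _ fun ω => ?_)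
  rcases le_total 0 (f ω) with h | h
  · simp only [abs_of_nonneg h, max_eq_left h]; ring
  · simp only [abs_of_nonpos h, max_eq_right h]; ring

end StopLoss

/-! ### Compatible parameters -/

section Compatible

variable {C : Type*} [MeasurableSpace C] {p : ℕ}

/-- The slopes `b` for which the conditional law of `X^x'b` is dominated by that of `Y^x` in the
convex order, expressed by stop-loss transforms. -/
def convexOrderSlopes (κY : Kernel C ℝ) (κX : Kernel C (EuclideanSpace ℝ (Fin p))) (x : C) :
    Set (EuclideanSpace ℝ (Fin p)) :=
  {b | ∀ t, ∫ v, max (inner ℝ (v - condMean κX x) b - t) 0 ∂(κX x) ≤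
    ∫ y, max (y - condMean κY x - t) 0 ∂(κY x)}

lemma stronglyMeasurable_condMean {E : Type*} [NormedAddCommGroup E] [NormedSpace ℝ E]
    [MeasurableSpace E] [BorelSpace E] [SecondCountableTopology E] (κ : Kernel C E)
    [IsSFiniteKernel κ] : StronglyMeasurable (condMean κ) :=
  stronglyMeasurable_id.integral_kernel

lemma integral_inner_left {μ : Measure (EuclideanSpace ℝ (Fin p))}
    (hμ : Integrable (fun v => v) μ) (b : EuclideanSpace ℝ (Fin p)) :
    ∫ v, inner ℝ v b ∂μ = inner ℝ (∫ v, v ∂μ) b := by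
  simp_rw [real_inner_comm b]
  exact integral_inner hμ b

variable {κY : Kernel C ℝ} [IsMarkovKernel κY] {κX : Kernel C (EuclideanSpace ℝ (Fin p))}
  [IsMarkovKernel κX]

lemma integrable_residual {x : C} (hX : Integrable (fun v => v) (κX x))
    (b : EuclideanSpace ℝ (Fin p)) :
    Integrable (fun v => inner ℝ (v - condMean κX x) b) (κX x) :=
  (hX.sub (integrable_const _)).inner_const b

lemma integral_residual {x : C} (hX : Integrable (fun v => v) (κX x))
    (b : EuclideanSpace ℝ (Fin p)) :
    ∫ v, inner ℝ (v - condMean κX x) b ∂(κX x) = 0 := by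
  simp_rw [inner_sub_left]
  rw [integral_sub (hX.inner_const b) (integrable_const _), integral_inner_left hX]
  simp [condMean]

lemma integrable_residualY {x : C} (hY : Integrable (fun y => y) (κY x)) :
    Integrable (fun y => y - condMean κY x) (κY x) := hY.sub (integrable_const _)

lemma integral_residualY {x : C} (hY : Integrable (fun y => y) (κY x)) :
    ∫ y, (y - condMean κY x) ∂(κY x) = 0 := by
  rw [integral_sub hY (integrable_const _)]
  simp [condMean]

/-- At mean zero, the first absolute moment is twice the stop-loss transform at `0`. The bound
serves both integrability of the index and boundedness of the slopes. -/
lemma integral_abs_residual_le {x : C} (hX : Integrable (fun v => v) (κX x))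
    (hY : Integrable (fun y => y) (κY x)) {b : EuclideanSpace ℝ (Fin p)}
    (hb : b ∈ convexOrderSlopes κY κX x) :
    ∫ v, |inner ℝ (v - condMean κX x) b| ∂(κX x) ≤ ∫ y, |y - condMean κY x| ∂(κY x) := by
  rw [integral_abs_eq_posPart (integrable_residual hX b), integral_residual hX,
    integral_abs_eq_posPart (integrable_residualY hY), integral_residualY hY]
  have := hb 0
  simp only [sub_zero] at this
  linarith

lemma ae_integrable_of_compProd {μ : Measure C} [SFinite μ]
    (hY : Integrable Prod.snd (μ ⊗ₘ κY)) : ∀ᵐ x ∂μ, Integrable (fun y => y) (κY x) :=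
  ((Measure.integrable_compProd_iff hY.aestronglyMeasurable).1 hY).1

/-- The index is integrable because it agrees with a conditional expectation, so no unconditional
moment of `X_nc` is needed. -/
lemma Rationalizes.setIntegral_eq {Pcy : Measure (C × ℝ)}
    {Pcx : Measure (C × EuclideanSpace ℝ (Fin p))} [IsFiniteMeasure Pcx]
    {b : EuclideanSpace ℝ (Fin p)} {g : C → ℝ} (hg : Measurable g)
    (h : Rationalizes Pcy Pcx b g) :
    Integrable (fun a => g a.1 + inner ℝ a.2 b) Pcx ∧
    ∃ ρ : Measure (C × EuclideanSpace ℝ (Fin p) × ℝ),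
      ρ.map (fun z => (z.1, z.2.2)) = Pcy ∧ ρ.map (fun z => (z.1, z.2.1)) = Pcx ∧
      IsFiniteMeasure ρ ∧
      Integrable (fun z => z.2.2) ρ ∧
      ∀ s, MeasurableSet s →
        ∫ z in (fun z => (z.1, z.2.1)) ⁻¹' s, (z.2.2) ∂ρ = ∫ a in s, (g a.1 + inner ℝ a.2 b) ∂Pcx := by
  obtain ⟨ρ, h1, h2, h3, h4⟩ := h
  have hT : Measurable fun z : C × EuclideanSpace ℝ (Fin p) × ℝ => (z.1, z.2.1) := by fun_prop
  have hψ : Measurable fun a : C × EuclideanSpace ℝ (Fin p) => g a.1 + inner ℝ a.2 b := by fun_prop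
  have hfin : IsFiniteMeasure ρ := by
    refine ⟨?_⟩
    have : ρ Set.univ = Pcx Set.univ := by rw [← h2, Measure.map_apply hT .univ, Set.preimage_univ]
    rw [this]
    exact measure_lt_top _ _
  have hψi : Integrable (fun z : C × EuclideanSpace ℝ (Fin p) × ℝ => g z.1 + inner ℝ z.2.1 b) ρ :=
    integrable_condExp.congr h4
  refine ⟨?_, ρ, h1, h2, hfin, h3, fun s hs => ?_⟩
  · rw [← h2]
    exact (integrable_map_measure hψ.aestronglyMeasurable hT.aemeasurable).2 hψi
  · rw [← h2, setIntegral_map hs hψ.aestronglyMeasurable hT.aemeasurable,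
      ← setIntegral_condExp hT.comap_le h3 ⟨s, hs, rfl⟩]
    exact setIntegral_congr_ae (hT hs) (h4.mono fun _ h _ => h)

variable {μ : Measure C} [IsFiniteMeasure μ]

/-- In a compatible pair the function is determined by the slope. -/
lemma Rationalizes.ae_eq (hY : Integrable Prod.snd (μ ⊗ₘ κY))
    (hX : ∀ᵐ x ∂μ, Integrable (fun v => v) (κX x))
    {b : EuclideanSpace ℝ (Fin p)} {g : C → ℝ} (hg : Measurable g)
    (h : Rationalizes (μ ⊗ₘ κY) (μ ⊗ₘ κX) b g) :
    g =ᵐ[μ] fun x => condMean κY x - inner ℝ (condMean κX x) b := by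
  obtain ⟨hψ, ρ, h1, h2, hfin, h3, h4⟩ := h.setIntegral_eq hg
  have hae : (fun x => ∫ v, (g x + inner ℝ v b) ∂(κX x)) =ᵐ[μ] condMean κY := by
    refine Integrable.ae_eq_of_forall_setIntegral_eq _ _ (integrable_integral_compProd hψ)
      (integrable_integral_compProd hY) fun s hs _ => ?_
    have e1 := h4 (s ×ˢ Set.univ) (hs.prod .univ)
    rw [Measure.setIntegral_compProd hs .univ hψ.integrableOn] at e1
    simp only [Measure.restrict_univ] at e1
    rw [← e1]
    have e2 := Measure.setIntegral_compProd hs .univ hY.integrableOn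
    simp only [Measure.restrict_univ] at e2
    unfold condMean
    rw [← e2, ← h1, setIntegral_map (hs.prod .univ) measurable_snd.aestronglyMeasurable
      (Measurable.aemeasurable (by fun_prop))]
    rfl
  filter_upwards [hae, hX] with x hx hXx
  rw [integral_add (integrable_const _) (hXx.inner_const b), integral_inner_left hXx] at hx
  simp only [integral_const, probReal_univ, one_smul] at hx
  rw [← hx]
  simp [condMean]

/-- Conditional Jensen for the positive part. On the set `U` where the centred index exceeds `t`,
the index may be replaced by `Y`; passing to the positive part and then dropping `U` only increases
the integral. -/
lemma Rationalizes.ae_mem_convexOrderSlopes (hY : Integrable Prod.snd (μ ⊗ₘ κY))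
    (hX : ∀ᵐ x ∂μ, Integrable (fun v => v) (κX x))
    {b : EuclideanSpace ℝ (Fin p)} {g : C → ℝ} (hg : Measurable g)
    (h : Rationalizes (μ ⊗ₘ κY) (μ ⊗ₘ κX) b g) :
    ∀ᵐ x ∂μ, b ∈ convexOrderSlopes κY κX x := by
  have hgeq := h.ae_eq hY hX hg
  obtain ⟨hψ, ρ, h1, h2, hfin, h3, h4⟩ := h.setIntegral_eq hg
  have hm : Measurable (condMean κY) := (stronglyMeasurable_condMean κY).measurable
  have hmi : Integrable (condMean κY) μ := integrable_integral_compProd hY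
  have hT : Measurable fun z : C × EuclideanSpace ℝ (Fin p) × ℝ => (z.1, z.2.1) := by fun_prop
  have hT' : Measurable fun z : C × EuclideanSpace ℝ (Fin p) × ℝ => (z.1, z.2.2) := by fun_prop
  have key : ∀ t : ℝ, ∀ᵐ x ∂μ, ∫ v, max (g x + inner ℝ v b - condMean κY x - t) 0 ∂(κX x) ≤
      ∫ y, max (y - condMean κY x - t) 0 ∂(κY x) := by
    intro t
    have hmX : Integrable (fun a : C × EuclideanSpace ℝ (Fin p) => condMean κY a.1) (μ ⊗ₘ κX) :=
      (integrable_map_measure hm.aestronglyMeasurable measurable_fst.aemeasurable).1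
        (by rw [← Measure.fst, Measure.fst_compProd]; exact hmi)
    have hmY : Integrable (fun a : C × ℝ => condMean κY a.1) (μ ⊗ₘ κY) :=
      (integrable_map_measure hm.aestronglyMeasurable measurable_fst.aemeasurable).1
        (by rw [← Measure.fst, Measure.fst_compProd]; exact hmi)
    have hfX : Integrable (fun a => g a.1 + inner ℝ a.2 b - condMean κY a.1 - t) (μ ⊗ₘ κX) :=
      (hψ.sub hmX).sub (integrable_const t)
    have hfY : Integrable (fun a => a.2 - condMean κY a.1 - t) (μ ⊗ₘ κY) :=
      (hY.sub hmY).sub (integrable_const t)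
    have hfXm : Measurable fun a : C × EuclideanSpace ℝ (Fin p) =>
      g a.1 + inner ℝ a.2 b - condMean κY a.1 - t := by fun_prop
    refine ae_le_of_forall_setIntegral_le (integrable_integral_compProd hfX.pos_part)
      (integrable_integral_compProd hfY.pos_part) fun s hs _ => ?_
    have eX := Measure.setIntegral_compProd hs .univ hfX.pos_part.integrableOn
    have eY := Measure.setIntegral_compProd hs .univ hfY.pos_part.integrableOn
    simp only [Measure.restrict_univ] at eX eY
    rw [← eX, ← eY]
    set U : Set (C × EuclideanSpace ℝ (Fin p)) :=
      {a | 0 < g a.1 + inner ℝ a.2 b - condMean κY a.1 - t} with hU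
    have hUm : MeasurableSet U := measurableSet_lt measurable_const hfXm
    have hsU : MeasurableSet ((s ×ˢ Set.univ) ∩ U) := (hs.prod .univ).inter hUm
    have hmρ : Integrable (fun z : C × EuclideanSpace ℝ (Fin p) × ℝ => condMean κY z.1) ρ := by
      rw [← h2] at hmX
      exact hmX.comp_measurable hT
    have hfρ : Integrable (fun z : C × EuclideanSpace ℝ (Fin p) × ℝ =>
        z.2.2 - condMean κY z.1 - t) ρ := (h3.sub hmρ).sub (integrable_const t)
    have e1 : ∫ a in s ×ˢ Set.univ, max (g a.1 + inner ℝ a.2 b - condMean κY a.1 - t) 0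
        ∂(μ ⊗ₘ κX) = ∫ a in (s ×ˢ Set.univ) ∩ U,
          (g a.1 + inner ℝ a.2 b - condMean κY a.1 - t) ∂(μ ⊗ₘ κX) := by
      rw [← setIntegral_indicator hUm]
      refine integral_congr_ae (ae_of_all _ fun a => ?_)
      by_cases ha : a ∈ U
      · rw [Set.indicator_of_mem ha]
        exact max_eq_left (le_of_lt ha)
      · rw [Set.indicator_of_notMem ha]
        exact max_eq_right (not_lt.1 ha)
    have e2 : ∫ a in (s ×ˢ Set.univ) ∩ U, (g a.1 + inner ℝ a.2 b - condMean κY a.1 - t)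
        ∂(μ ⊗ₘ κX) = ∫ z in (fun z => (z.1, z.2.1)) ⁻¹' ((s ×ˢ Set.univ) ∩ U),
          (z.2.2 - condMean κY z.1 - t) ∂ρ := by
      have e3 : ∫ a in (s ×ˢ Set.univ) ∩ U, (condMean κY a.1 + t) ∂(μ ⊗ₘ κX) =
          ∫ z in (fun z => (z.1, z.2.1)) ⁻¹' ((s ×ˢ Set.univ) ∩ U), (condMean κY z.1 + t) ∂ρ := by
        rw [← h2, setIntegral_map hsU (Measurable.aestronglyMeasurable (by fun_prop))
          hT.aemeasurable]
      have hmX' : Integrable (fun a : C × EuclideanSpace ℝ (Fin p) => condMean κY a.1 + t)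
        (μ ⊗ₘ κX) := hmX.add (integrable_const t)
      have hmρ' : Integrable (fun z : C × EuclideanSpace ℝ (Fin p) × ℝ => condMean κY z.1 + t) ρ :=
        hmρ.add (integrable_const t)
      simp_rw [sub_sub]
      rw [integral_sub hψ.integrableOn hmX'.integrableOn, e3,
        integral_sub h3.integrableOn hmρ'.integrableOn, h4 _ hsU]
    have e4 : ∫ a in s ×ˢ Set.univ, max (a.2 - condMean κY a.1 - t) 0 ∂(μ ⊗ₘ κY) =
        ∫ z in (fun z => (z.1, z.2.1)) ⁻¹' (s ×ˢ Set.univ),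
          max (z.2.2 - condMean κY z.1 - t) 0 ∂ρ := by
      rw [← h1, setIntegral_map (hs.prod .univ) (Measurable.aestronglyMeasurable (by fun_prop))
        hT'.aemeasurable]
      rfl
    rw [e1, e2, e4]
    refine (setIntegral_mono hfρ.integrableOn hfρ.pos_part.integrableOn
      fun z => le_max_left _ _).trans ?_
    exact setIntegral_mono_set hfρ.pos_part.integrableOn (ae_of_all _ fun z => le_max_right _ _)
      (Set.preimage_mono Set.inter_subset_left).eventuallyLE
  -- The exceptional null set depends on `t`: rational thresholds are treated together, and
  -- continuity gives the others.
  filter_upwards [hgeq, hX, ae_integrable_of_compProd hY,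
    ae_all_iff.2 fun q : ℚ => key q] with x hgx hXx hYx hq t
  refine Rat.denseRange_cast.induction_on (p := fun t : ℝ =>
    ∫ v, max (inner ℝ (v - condMean κX x) b - t) 0 ∂(κX x) ≤
      ∫ y, max (y - condMean κY x - t) 0 ∂(κY x)) t ?_ fun q => ?_
  · exact isClosed_le (continuous_integral_posPart (integrable_residual hXx b))
      (continuous_integral_posPart (integrable_residualY hYx))
  · refine le_trans (le_of_eq ?_) (hq q)
    refine integral_congr_ae (ae_of_all _ fun v => ?_)
    simp only [hgx, inner_sub_left]
    congr 1
    ring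

variable [MeasurableEq C]

lemma rationalizes_of_ae_mem_convexOrderSlopes (hY : Integrable Prod.snd (μ ⊗ₘ κY))
    (hX : ∀ᵐ x ∂μ, Integrable (fun v => v) (κX x))
    {b : EuclideanSpace ℝ (Fin p)} {g : C → ℝ} (hg : Measurable g)
    (hgeq : g =ᵐ[μ] fun x => condMean κY x - inner ℝ (condMean κX x) b)
    (hb : ∀ᵐ x ∂μ, b ∈ convexOrderSlopes κY κX x) :
    Rationalizes (μ ⊗ₘ κY) (μ ⊗ₘ κX) b g := by
  have hψ : Measurable fun a : C × EuclideanSpace ℝ (Fin p) => g a.1 + inner ℝ a.2 b := by fun_prop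
  have hψx : ∀ x, Measurable fun v : EuclideanSpace ℝ (Fin p) => g x + inner ℝ v b := by fun_prop
  have hφ : Measurable fun a : C × EuclideanSpace ℝ (Fin p) => (a.1, g a.1 + inner ℝ a.2 b) := by
    fun_prop
  set κ₁ : Kernel C ℝ := (Kernel.id ×ₖ κX).map fun a => g a.1 + inner ℝ a.2 b with hκ₁def
  have hκ₁ : ∀ x, κ₁ x = (κX x).map fun v => g x + inner ℝ v b := fun x => by
    rw [hκ₁def, Kernel.map_apply _ hψ, Kernel.prod_apply, Kernel.id_apply, Measure.dirac_prod,
      Measure.map_map hψ (by fun_prop)]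
    rfl
  have hκ₁m : IsMarkovKernel κ₁ := Kernel.IsMarkovKernel.map _ hψ
  have hP : (μ ⊗ₘ κX).map (fun a => (a.1, g a.1 + inner ℝ a.2 b)) = μ ⊗ₘ κ₁ := by
    refine Measure.ext_of_lintegral _ fun f hf => ?_
    have hfφ : Measurable fun a : C × EuclideanSpace ℝ (Fin p) =>
      f (a.1, g a.1 + inner ℝ a.2 b) := hf.comp hφ
    rw [lintegral_map hf hφ, Measure.lintegral_compProd hfφ, Measure.lintegral_compProd hf]
    refine lintegral_congr fun x => ?_
    have hfx : Measurable fun y => f (x, y) := hf.comp measurable_prodMk_left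
    rw [hκ₁ x, lintegral_map hfx (hψx x)]
  have hYae := ae_integrable_of_compProd hY
  have hYnorm : Integrable (fun x => ∫ y, |y| ∂(κY x)) μ := by
    simpa using integrable_integral_compProd hY.norm
  have hψi : Integrable (fun a => g a.1 + inner ℝ a.2 b) (μ ⊗ₘ κX) := by
    rw [Measure.integrable_compProd_iff hψ.aestronglyMeasurable]
    refine ⟨?_, ?_⟩
    · filter_upwards [hX] with x hx using (integrable_const _).add (hx.inner_const b)
    -- The constant 3: the index has absolute mean at most `|m_Y| + E|Y^x|`, where `|m_Y| ≤ E|Y|`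
    -- and `E|Y^x| ≤ 2 E|Y|`, all conditional on `x`.
    · refine (hYnorm.const_mul 3).mono' (StronglyMeasurable.integral_kernel_prod_right'
        (f := fun a => ‖g a.1 + inner ℝ a.2 b‖) hψ.norm.stronglyMeasurable).aestronglyMeasurable ?_
      filter_upwards [hX, hYae, hb, hgeq] with x hx hy hbx hgx
      rw [Real.norm_of_nonneg (integral_nonneg fun _ => norm_nonneg _)]
      have hres := integral_abs_residual_le hx hy hbx
      have hmabs : |condMean κY x| ≤ ∫ y, |y| ∂(κY x) := abs_integral_le_integral_abs
      have h1 : ∫ v, ‖g x + inner ℝ v b‖ ∂(κX x) ≤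
          ∫ v, (|condMean κY x| + |inner ℝ (v - condMean κX x) b|) ∂(κX x) := by
        refine integral_mono ((integrable_const _).add (hx.inner_const b)).norm
          ((integrable_const _).add (integrable_residual hx b).abs) fun v => ?_
        simp only [Real.norm_eq_abs, hgx, inner_sub_left]
        refine le_trans (le_of_eq ?_) (abs_add_le _ _)
        congr 1
        ring
      have h2 : ∫ y, |y - condMean κY x| ∂(κY x) ≤ ∫ y, (|y| + |condMean κY x|) ∂(κY x) :=
        integral_mono (integrable_residualY hy).abs (hy.abs.add (integrable_const _))
          fun y => abs_sub _ _
      rw [integral_add (integrable_const _) (integrable_residual hx b).abs] at h1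
      rw [integral_add hy.abs (integrable_const _)] at h2
      simp only [integral_const, probReal_univ, one_smul] at h1 h2
      linarith
  have h₁ : Integrable Prod.snd (μ ⊗ₘ κ₁) := by
    rw [← hP]
    exact (integrable_map_measure measurable_snd.aestronglyMeasurable hφ.aemeasurable).2 hψi
  have hmean : ∀ᵐ x ∂μ, ∫ y, y ∂(κ₁ x) = ∫ y, y ∂(κY x) := by
    filter_upwards [hX, hgeq] with x hx hgx
    rw [hκ₁, integral_map (hψx x).aemeasurable (by fun_prop),
      integral_add (integrable_const _) (hx.inner_const b), integral_inner_left hx]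
    simp [hgx, condMean]
  have hcx : ∀ᵐ x ∂μ, ∀ t, ∫ y, max (y - t) 0 ∂(κ₁ x) ≤ ∫ y, max (y - t) 0 ∂(κY x) := by
    filter_upwards [hb, hgeq] with x hbx hgx t
    rw [hκ₁, integral_map (hψx x).aemeasurable (Measurable.aestronglyMeasurable (by fun_prop))]
    convert hbx (t - condMean κY x) using 4
    · simp only [hgx, inner_sub_left]
      ring
    · ring
  obtain ⟨R, hR1, hR2, hR3⟩ := exists_martingale_coupling μ κ₁ κY h₁ hY hmean hcx
  have hJ : Measurable fun z : C × ℝ × ℝ => ((z.1, z.2.1), z.2.2) := by fun_prop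
  have hRfst : (R.map fun z => ((z.1, z.2.1), z.2.2)).fst = μ ⊗ₘ κ₁ := by
    rw [Measure.fst, Measure.map_map measurable_fst hJ]
    exact hR1
  have hRfin : IsFiniteMeasure R := by
    refine ⟨?_⟩
    have : R Set.univ = (μ ⊗ₘ κ₁) Set.univ := by
      rw [← hR1, Measure.map_apply (by fun_prop) .univ, Set.preimage_univ]
    rw [this]
    exact measure_lt_top _ _
  have hRi : Integrable (fun z : C × ℝ × ℝ => z.2.2) R := by
    rw [← hR2] at hY
    exact hY.comp_measurable (by fun_prop)
  obtain ⟨θ, hθ1, hθ2, hθ3⟩ := exists_glue (μ ⊗ₘ κX) hφ (R.map fun z => ((z.1, z.2.1), z.2.2))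
    (by rw [hRfst, hP])
    ((integrable_map_measure measurable_snd.aestronglyMeasurable hJ.aemeasurable).2 hRi)
    (ψ := Prod.snd) (by rwa [hRfst]) (fun s hs => by
      rw [hRfst, setIntegral_map (measurable_fst hs) measurable_snd.aestronglyMeasurable
        hJ.aemeasurable]
      exact hR3 s hs)
  have hK : Measurable fun z : (C × EuclideanSpace ℝ (Fin p)) × ℝ => (z.1.1, z.1.2, z.2) := by
    fun_prop
  have hT : Measurable fun z : C × EuclideanSpace ℝ (Fin p) × ℝ => (z.1, z.2.1) := by fun_prop
  have hT' : Measurable fun z : C × EuclideanSpace ℝ (Fin p) × ℝ => (z.1, z.2.2) := by fun_prop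
  have hρ1 : (θ.map fun z => (z.1.1, z.1.2, z.2)).map (fun z => (z.1, z.2.2)) = μ ⊗ₘ κY := by
    have h := congrArg (Measure.map fun z : (C × ℝ) × ℝ => (z.1.1, z.2)) hθ2
    rw [Measure.map_map (by fun_prop) (hφ.prodMap measurable_id),
      Measure.map_map (by fun_prop) hJ] at h
    rw [Measure.map_map hT' hK, ← hR2]
    exact h
  have hρ2 : (θ.map fun z => (z.1.1, z.1.2, z.2)).map (fun z => (z.1, z.2.1)) = μ ⊗ₘ κX := by
    rw [Measure.map_map hT hK, ← hθ1]
    rfl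
  have hρfin : IsFiniteMeasure (θ.map fun z => (z.1.1, z.1.2, z.2)) := by
    refine ⟨?_⟩
    have := congrArg (fun m : Measure (C × EuclideanSpace ℝ (Fin p)) => m Set.univ) hρ2
    simp only [Measure.map_apply hT .univ, Set.preimage_univ] at this
    rw [this]
    exact measure_lt_top _ _
  have hρi : Integrable (fun z : C × EuclideanSpace ℝ (Fin p) × ℝ => z.2.2)
      (θ.map fun z => (z.1.1, z.1.2, z.2)) := by
    rw [← hρ1] at hY
    exact hY.comp_measurable hT'
  have hρψ : Integrable (fun z : C × EuclideanSpace ℝ (Fin p) × ℝ => g z.1 + inner ℝ z.2.1 b)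
      (θ.map fun z => (z.1.1, z.1.2, z.2)) := by
    rw [← hρ2] at hψi
    exact hψi.comp_measurable hT
  refine ⟨θ.map fun z => (z.1.1, z.1.2, z.2), hρ1, hρ2, hρi, ?_⟩
  refine (ae_eq_condExp_of_forall_setIntegral_eq hT.comap_le hρi
    (fun _ _ _ => hρψ.integrableOn) ?_ ?_).symm
  · rintro _ ⟨s, hs, rfl⟩ -
    have e1 : ∫ z in (fun z : C × EuclideanSpace ℝ (Fin p) × ℝ => (z.1, z.2.1)) ⁻¹' s,
        (g z.1 + inner ℝ z.2.1 b) ∂(θ.map fun z => (z.1.1, z.1.2, z.2)) =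
        ∫ a in s, (g a.1 + inner ℝ a.2 b) ∂(μ ⊗ₘ κX) := by
      rw [← hρ2, setIntegral_map hs hψ.aestronglyMeasurable hT.aemeasurable]
    rw [e1, setIntegral_map (hT hs) hρi.aestronglyMeasurable hK.aemeasurable]
    exact (hθ3 s hs).symm
  · refine StronglyMeasurable.aestronglyMeasurable (Measurable.stronglyMeasurable ?_)
    exact hψ.comp (comap_measurable _)

end Compatible

/-! ### Geometry of the set of slopes -/

section Slopes

variable {C : Type*} [MeasurableSpace C] {p : ℕ}
variable {κY : Kernel C ℝ} {κX : Kernel C (EuclideanSpace ℝ (Fin p))}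
  [IsMarkovKernel κX]

lemma isClosed_convexOrderSlopes {x : C} (hX : Integrable (fun v => v) (κX x)) :
    IsClosed (convexOrderSlopes κY κX x) := by
  simp only [convexOrderSlopes, Set.ofPred_forall]
  refine isClosed_iInter fun t => isClosed_le ?_ continuous_const
  have hi : Integrable (fun v => ‖v - condMean κX x‖) (κX x) := (hX.sub (integrable_const _)).norm
  refine (LipschitzWith.of_dist_le' (K := ∫ v, ‖v - condMean κX x‖ ∂(κX x))
    fun b c => ?_).continuous
  refine (abs_integral_posPart_sub_le ((integrable_residual hX b).sub (integrable_const t))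
    ((integrable_residual hX c).sub (integrable_const t))).trans ?_
  rw [← integral_mul_const]
  refine integral_mono (((integrable_residual hX b).sub (integrable_const t)).sub
    ((integrable_residual hX c).sub (integrable_const t))).abs (hi.mul_const _) fun v => ?_
  rw [dist_eq_norm]
  refine (le_of_eq ?_).trans (abs_real_inner_le_norm (v - condMean κX x) (b - c))
  simp only [inner_sub_right, Pi.sub_apply]
  congr 1
  ring

/-- The stop-loss transform of `X^x'b` is convex in `b`, and its upper bound does not involve `b`.
-/
lemma convex_convexOrderSlopes {x : C} (hX : Integrable (fun v => v) (κX x)) :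
    Convex ℝ (convexOrderSlopes κY κX x) := by
  intro b hb c hc r s hr hs hrs t
  have hib := (integrable_posPart_sub (integrable_residual hX b) t).const_mul r
  have hic := (integrable_posPart_sub (integrable_residual hX c) t).const_mul s
  have h1 : ∫ v, max (inner ℝ (v - condMean κX x) (r • b + s • c) - t) 0 ∂(κX x) ≤
      ∫ v, (r * max (inner ℝ (v - condMean κX x) b - t) 0
        + s * max (inner ℝ (v - condMean κX x) c - t) 0) ∂(κX x) := by
    refine integral_mono (integrable_posPart_sub (integrable_residual hX _) t) (hib.add hic)
      fun v => max_le ?_ (by positivity)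
    have e1 := mul_le_mul_of_nonneg_left
      (le_max_left (inner ℝ (v - condMean κX x) b - t) 0) hr
    have e2 := mul_le_mul_of_nonneg_left
      (le_max_left (inner ℝ (v - condMean κX x) c - t) 0) hs
    have e3 : t = r * t + s * t := by rw [← add_mul, hrs, one_mul]
    rw [inner_add_right, inner_smul_right, inner_smul_right]
    linarith
  rw [integral_add hib hic, integral_const_mul, integral_const_mul] at h1
  have h2 := mul_le_mul_of_nonneg_left (hb t) hr
  have h3 := mul_le_mul_of_nonneg_left (hc t) hs
  refine h1.trans ((add_le_add h2 h3).trans (le_of_eq ?_))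
  rw [← add_mul, hrs, one_mul]

lemma zero_mem_convexOrderSlopes [IsMarkovKernel κY] {x : C} (hY : Integrable (fun y => y) (κY x)) :
    (0 : EuclideanSpace ℝ (Fin p)) ∈ convexOrderSlopes κY κX x := by
  intro t
  simp only [inner_zero_right, integral_const, probReal_univ, one_smul, zero_sub]
  refine max_le ?_ (integral_nonneg fun _ => le_max_right _ _)
  have h := integral_mono ((integrable_residualY hY).sub (integrable_const t))
    (integrable_posPart_sub (integrable_residualY hY) t) fun y => le_max_left _ _
  simp only [Pi.sub_apply] at h
  have e : ∫ y, (y - condMean κY x - t) ∂(κY x) = -t := by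
    rw [integral_sub (integrable_residualY hY) (integrable_const t), integral_residualY hY]
    simp
  linarith

/-- If the moment vanished, `X^x'b` would be zero almost surely and the covariance matrix would send
`b` to `0`. -/
lemma integral_abs_residual_pos {x : C} (hX : MemLp (fun v => v) 2 (κX x))
    (hns : IsUnit (condCovMatrix κX x)) {b : EuclideanSpace ℝ (Fin p)} (hb : b ≠ 0) :
    0 < ∫ v, |inner ℝ (v - condMean κX x) b| ∂(κX x) := by
  refine lt_of_le_of_ne (integral_nonneg fun _ => abs_nonneg _) fun h0 => hb ?_
  have hX1 : Integrable (fun v => v) (κX x) := hX.integrable (by norm_num)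
  have hz := (integral_eq_zero_iff_of_nonneg (fun _ => abs_nonneg _)
    (integrable_residual hX1 b).abs).1 h0.symm
  have hX2 : MemLp (fun v => v - condMean κX x) 2 (κX x) := hX.sub (memLp_const _)
  have hco : ∀ i, MemLp (fun v => (v - condMean κX x) i) 2 (κX x) := fun i =>
    hX2.mono ((EuclideanSpace.proj (𝕜 := ℝ) i).continuous.comp_aestronglyMeasurable hX2.1)
      (ae_of_all _ fun v => PiLp.norm_apply_le _ i)
  have hmul : (condCovMatrix κX x).mulVec b = 0 := by
    ext i
    have hin : ∀ j, Integrable (fun v => (v - condMean κX x) i * (v - condMean κX x) j * b j)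
      (κX x) := fun j => ((hco i).integrable_mul (hco j)).mul_const _
    have : (condCovMatrix κX x).mulVec b i =
        ∫ v, (v - condMean κX x) i * inner ℝ (v - condMean κX x) b ∂(κX x) := by
      simp only [Matrix.mulVec, dotProduct, condCovMatrix, Matrix.of_apply]
      simp_rw [← integral_mul_const]
      rw [← integral_finsetSum _ fun j _ => hin j]
      refine integral_congr_ae (ae_of_all _ fun v => ?_)
      simp only [PiLp.inner_apply, Finset.mul_sum]
      refine Finset.sum_congr rfl fun j _ => ?_
      simp only [RCLike.inner_apply, conj_trivial]
      ring
    rw [this, Pi.zero_apply]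
    refine integral_eq_zero_of_ae ?_
    filter_upwards [hz] with v hv
    simp only [Pi.zero_apply, abs_eq_zero] at hv
    simp [hv]
  have h1 := Matrix.mulVec_injective_of_isUnit hns (hmul.trans (Matrix.mulVec_zero _).symm)
  ext i
  exact congrFun h1 i

/-- The map `b ↦ E|X^x'b|` is continuous, homogeneous and positive off `0`, so compactness of the
sphere bounds it below by a multiple of `‖b‖`; on admissible slopes it is at most `E|Y^x|`. -/
lemma isBounded_convexOrderSlopes [IsMarkovKernel κY] {x : C} (hY : Integrable (fun y => y) (κY x))
    (hX : MemLp (fun v => v) 2 (κX x)) (hns : IsUnit (condCovMatrix κX x)) :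
    Bornology.IsBounded (convexOrderSlopes κY κX x) := by
  have hX1 : Integrable (fun v => v) (κX x) := hX.integrable (by norm_num)
  set N : EuclideanSpace ℝ (Fin p) → ℝ := fun b => ∫ v, |inner ℝ (v - condMean κX x) b| ∂(κX x)
    with hN
  have hNc : Continuous N := by
    refine (LipschitzWith.of_dist_le' (K := ∫ v, ‖v - condMean κX x‖ ∂(κX x))
      fun b c => ?_).continuous
    rw [← integral_mul_const, Real.dist_eq, hN,
      ← integral_sub (integrable_residual hX1 b).abs (integrable_residual hX1 c).abs]
    refine abs_integral_le_integral_abs.trans (integral_mono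
      ((integrable_residual hX1 b).abs.sub (integrable_residual hX1 c).abs).abs
      ((hX1.sub (integrable_const _)).norm.mul_const _) fun v => ?_)
    refine (abs_abs_sub_abs_le_abs_sub _ _).trans ?_
    rw [← inner_sub_right, dist_eq_norm]
    exact abs_real_inner_le_norm _ _
  -- An empty sphere leaves only the zero vector.
  rcases (Metric.sphere (0 : EuclideanSpace ℝ (Fin p)) 1).eq_empty_or_nonempty with he | hne
  · refine (Metric.isBounded_closedBall (x := (0 : EuclideanSpace ℝ (Fin p))) (r := 0)).subset
      fun b _ => ?_
    by_contra hb
    have hb' : ‖b‖ ≠ 0 := fun h => hb (by simp [norm_eq_zero.1 h])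
    have : ‖b‖⁻¹ • b ∈ Metric.sphere (0 : EuclideanSpace ℝ (Fin p)) 1 := by
      simp [norm_smul, hb']
    simp [he] at this
  obtain ⟨q, hq, hmin⟩ := (isCompact_sphere (0 : EuclideanSpace ℝ (Fin p)) 1).exists_isMinOn hne
    hNc.continuousOn
  have hq1 : ‖q‖ = 1 := by simpa using hq
  have hpos : 0 < N q := integral_abs_residual_pos hX hns (norm_ne_zero_iff.1 (by simp [hq1]))
  refine (Metric.isBounded_closedBall (x := (0 : EuclideanSpace ℝ (Fin p)))
    (r := (∫ y, |y - condMean κY x| ∂(κY x)) / N q)).subset fun b hb => ?_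
  rw [mem_closedBall_zero_iff, le_div_iff₀ hpos]
  refine le_trans ?_ (integral_abs_residual_le hX1 hY hb)
  rcases eq_or_ne b 0 with rfl | hb0
  · simp
  have hbn : ‖b‖ ≠ 0 := norm_ne_zero_iff.2 hb0
  have hu : ‖b‖⁻¹ • b ∈ Metric.sphere (0 : EuclideanSpace ℝ (Fin p)) 1 := by
    simp [norm_smul, hbn]
  have h1 : N q ≤ N (‖b‖⁻¹ • b) := hmin hu
  have h2 : N (‖b‖⁻¹ • b) = ‖b‖⁻¹ * N b := by
    simp only [hN, inner_smul_right, abs_mul, abs_inv, abs_norm, integral_const_mul]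
  calc ‖b‖ * N q ≤ ‖b‖ * (‖b‖⁻¹ * N b) := by
        rw [← h2]; exact mul_le_mul_of_nonneg_left h1 (norm_nonneg _)
    _ = N b := by rw [← mul_assoc, mul_inv_cancel₀ hbn, one_mul]

/-! ### The radial function -/

lemma integral_tail_pos {ξ : ℝ → ℝ} (hm : MonotoneOn ξ (Set.Ioo 0 1))
    (hi : Integrable ξ unitLebesgue) (h0 : ∫ u, ξ u ∂unitLebesgue = 0)
    (hpos : 0 < ∫ u, |ξ u| ∂unitLebesgue) {a : ℝ} (ha : a ∈ Set.Ioo (0 : ℝ) 1) :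
    0 < ∫ u in a..1, ξ u := by
  by_contra! hle
  have h1 := integral_tail_eq_posPart hi (Set.Ioo_subset_Icc_self ha) (t := ξ a)
    fun u hu => ⟨fun h => hm ha hu h.le, fun h => hm hu ha h.le⟩
  have h2 : 0 ≤ ∫ u, max (ξ u - ξ a) 0 ∂unitLebesgue := integral_nonneg fun _ => le_max_right _ _
  have h3 : ∫ u, (ξ u - ξ a) ∂unitLebesgue ≤ ∫ u, max (ξ u - ξ a) 0 ∂unitLebesgue :=
    integral_mono (hi.sub (integrable_const _)) (integrable_posPart_sub hi _)
      fun u => le_max_left _ _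
  rw [integral_sub hi (integrable_const _), h0] at h3
  simp only [integral_const, probReal_univ, one_smul] at h3
  -- A nonpositive tail forces `ξ a = 0`; then `E ξ⁺` equals that tail and vanishes, against `E|ξ| >
  -- 0`.
  have hle0 : ξ a ≤ 0 := by nlinarith [ha.2]
  have hge0 : 0 ≤ ξ a := by nlinarith [ha.1]
  have hz : ξ a = 0 := le_antisymm hle0 hge0
  rw [integral_abs_eq_posPart hi, h0] at hpos
  simp only [hz, sub_zero] at h1
  linarith

lemma integral_tail_genInv_cdf (σ : Measure ℝ) [IsProbabilityMeasure σ] {a : ℝ}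
    (ha : a ∈ Set.Ioo (0 : ℝ) 1) :
    ∫ t in a..1, genInv (cdf σ) t = ∫ t in a..1, quantileFun σ t := by
  rw [intervalIntegral.integral_of_le ha.2.le, intervalIntegral.integral_of_le ha.2.le,
    integral_Ioc_eq_integral_Ioo, integral_Ioc_eq_integral_Ioo]
  exact setIntegral_congr_fun measurableSet_Ioo fun t ht =>
    (quantileFun_eq_genInv_cdf σ ⟨ha.1.trans ht.1, ht.2⟩).symm

/-- Positive denominators turn a lower bound on every ratio into domination of tail integrals, and
duality turns that into stop-loss domination. The sign of `l` keeps `l` times a quantile function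
monotone. -/
lemma le_condRadialS_iff [IsMarkovKernel κY] {x : C} (hY : Integrable (fun y => y) (κY x))
    (hX : MemLp (fun v => v) 2 (κX x)) (hns : IsUnit (condCovMatrix κX x))
    {q : EuclideanSpace ℝ (Fin p)} (hq : q ≠ 0) {l : ℝ} (hl : 0 ≤ l) :
    (l : EReal) ≤ condRadialS κY κX q x ↔ l • q ∈ convexOrderSlopes κY κX x := by
  have hX1 : Integrable (fun v => v) (κX x) := hX.integrable (by norm_num)
  have hmY : Measurable fun y => y - condMean κY x := by fun_prop
  have hmX : Measurable fun v => inner ℝ (v - condMean κX x) q := by fun_prop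
  set νY := (κY x).map fun y => y - condMean κY x with hνY
  set νX := (κX x).map fun v => inner ℝ (v - condMean κX x) q with hνX
  have hpY : IsProbabilityMeasure νY := Measure.isProbabilityMeasure_map hmY.aemeasurable
  have hpX : IsProbabilityMeasure νX := Measure.isProbabilityMeasure_map hmX.aemeasurable
  have hiY : Integrable (quantileFun νY) unitLebesgue := integrable_quantileFun _
    ((integrable_map_measure measurable_id.aestronglyMeasurable hmY.aemeasurable).2
      (integrable_residualY hY))
  have hiX : Integrable (quantileFun νX) unitLebesgue := integrable_quantileFun _
    ((integrable_map_measure measurable_id.aestronglyMeasurable hmX.aemeasurable).2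
      (integrable_residual hX1 q))
  have hqX : ∀ {f : ℝ → ℝ}, Measurable f → ∫ u, f (quantileFun νX u) ∂unitLebesgue =
      ∫ v, f (inner ℝ (v - condMean κX x) q) ∂(κX x) := fun hf => by
    rw [integral_comp_quantileFun νX hf, hνX, integral_map hmX.aemeasurable
      hf.aestronglyMeasurable]
  have hqY : ∀ {f : ℝ → ℝ}, Measurable f → ∫ u, f (quantileFun νY u) ∂unitLebesgue =
      ∫ y, f (y - condMean κY x) ∂(κY x) := fun hf => by
    rw [integral_comp_quantileFun νY hf, hνY, integral_map hmY.aemeasurable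
      hf.aestronglyMeasurable]
  have h0X : ∫ u, quantileFun νX u ∂unitLebesgue = 0 := by
    rw [hqX (f := fun z => z) measurable_id, integral_residual hX1]
  have h0Y : ∫ u, quantileFun νY u ∂unitLebesgue = 0 := by
    rw [hqY (f := fun z => z) measurable_id, integral_residualY hY]
  have hposX : 0 < ∫ u, |quantileFun νX u| ∂unitLebesgue := by
    rw [hqX (f := fun z => |z|) (by fun_prop)]
    exact integral_abs_residual_pos hX hns hq
  have hmonoX : MonotoneOn (quantileFun νX) (Set.Ioo 0 1) := by
    simpa using quantileFun_monotoneOn νX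
  have hmonoY : MonotoneOn (quantileFun νY) (Set.Ioo 0 1) := by
    simpa using quantileFun_monotoneOn νY
  have hden : ∀ a ∈ Set.Ioo (0 : ℝ) 1, 0 < ∫ u in a..1, quantileFun νX u := fun a ha =>
    integral_tail_pos hmonoX hiX h0X hposX ha
  have htail := tail_le_iff_posPart_le (ξ := fun u => l * quantileFun νX u)
    (fun u hu w hw huw => mul_le_mul_of_nonneg_left (hmonoX hu hw huw) hl) hmonoY
    (hiX.const_mul l) hiY (by rw [integral_const_mul, h0X, h0Y, mul_zero])
  rw [condRadialS, radialS, le_iInf₂_iff]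
  trans ∀ a ∈ Set.Ioo (0 : ℝ) 1,
    ∫ u in a..1, l * quantileFun νX u ≤ ∫ u in a..1, quantileFun νY u
  · refine forall₂_congr fun a ha => ?_
    rw [EReal.coe_le_coe_iff, superquantileRatio, cdfResidualY, cdfResidualX,
      integral_tail_genInv_cdf νY ha, integral_tail_genInv_cdf νX ha, le_div_iff₀ (hden a ha),
      intervalIntegral.integral_const_mul]
  · rw [htail]
    refine forall_congr' fun t => ?_
    rw [hqX (f := fun z => max (l * z - t) 0) (by fun_prop),
      hqY (f := fun z => max (z - t) 0) (by fun_prop)]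
    simp only [inner_smul_right]

end Slopes

/-! ### Identified sets -/

lemma eq_starSet {p : ℕ} (hp : 1 ≤ p) {B : Set (EuclideanSpace ℝ (Fin p))}
    {r : EuclideanSpace ℝ (Fin p) → EReal}
    (h : ∀ q, ‖q‖ = 1 → ∀ l : ℝ, 0 ≤ l → ((l : EReal) ≤ r q ↔ l • q ∈ B)) : B = starSet r := by
  ext b
  constructor
  · intro hb
    rcases eq_or_ne b 0 with rfl | hb0
    · have hq : ‖EuclideanSpace.single (⟨0, hp⟩ : Fin p) (1 : ℝ)‖ = 1 := by simp
      exact ⟨_, hq, 0, le_rfl, (h _ hq 0 le_rfl).2 (by rwa [zero_smul]), (zero_smul _ _).symm⟩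
    · have hbn : ‖b‖ ≠ 0 := norm_ne_zero_iff.2 hb0
      have hq : ‖‖b‖⁻¹ • b‖ = 1 := by simp [norm_smul, hbn]
      have hbq : b = ‖b‖ • ‖b‖⁻¹ • b := by rw [smul_smul, mul_inv_cancel₀ hbn, one_smul]
      exact ⟨_, hq, ‖b‖, norm_nonneg b, (h _ hq _ (norm_nonneg b)).2 (hbq ▸ hb), hbq⟩
  · rintro ⟨q, hq, l, hl, hlr, rfl⟩
    exact (h q hq l hl).1 hlr

/-- The centring moves with `z`, so the integrand is not fixed. Freezing it at `x` costs at most the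
change in the mean of `f`, which tends to `0` by continuity applied to `f` itself. -/
lemma tendsto_integral_posPart_of_W1 {C E : Type*} [MeasurableSpace C] [TopologicalSpace C]
    [NormedAddCommGroup E] [NormedSpace ℝ E] [CompleteSpace E] [MeasurableSpace E] [BorelSpace E]
    {κ : Kernel C E} [IsMarkovKernel κ] {s : Set C} {x : C} (hx : x ∈ s)
    (hi : ∀ z ∈ s, Integrable (fun v => v) (κ z)) (hW : W1ContinuousWithinAt κ s x)
    (f : E →L[ℝ] ℝ) (t : ℝ) :
    Tendsto (fun z => ∫ v, max (f (v - condMean κ z) - t) 0 ∂(κ z)) (𝓝[s] x)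
      (𝓝 (∫ v, max (f (v - condMean κ x) - t) 0 ∂(κ x))) := by
  have hf : ∀ v, |f v| ≤ ‖f‖ * (1 + ‖v‖) := fun v =>
    (f.le_opNorm v).trans (mul_le_mul_of_nonneg_left (by simp) (norm_nonneg f))
  have hmean : ∀ z ∈ s, f (condMean κ z) = ∫ v, f v ∂(κ z) := fun z hz =>
    (f.integral_comp_comm (hi z hz)).symm
  have hm : Tendsto (fun z => f (condMean κ z)) (𝓝[s] x) (𝓝 (f (condMean κ x))) := by
    rw [hmean x hx]
    exact (hW f f.continuous ⟨_, hf⟩).congr' (by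
      filter_upwards [self_mem_nhdsWithin] with z hz using (hmean z hz).symm)
  set c := f (condMean κ x) + t with hc
  have h1 := hW (fun v => max (f v - c) 0) (by fun_prop) ⟨‖f‖ + |c|, fun v => by
    rw [abs_of_nonneg (le_max_right _ _)]
    refine max_le ?_ (by positivity)
    have := abs_nonneg c
    have h2 := le_trans (le_abs_self _) (hf v)
    have h3 := neg_abs_le c
    have h4 : |c| * 1 ≤ |c| * (1 + ‖v‖) := mul_le_mul_of_nonneg_left (by simp) this
    rw [add_mul]
    linarith⟩
  have h2 : Tendsto (fun z => ∫ v, max (f (v - condMean κ z) - t) 0 ∂(κ z)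
      - ∫ v, max (f v - c) 0 ∂(κ z)) (𝓝[s] x) (𝓝 0) := by
    refine squeeze_zero_norm' (a := fun z => |f (condMean κ x) - f (condMean κ z)|) ?_ ?_
    · filter_upwards [self_mem_nhdsWithin] with z hz
      have hfi : Integrable (fun v => f v) (κ z) := f.integrable_comp (hi z hz)
      have hfi' : Integrable (fun v => f (v - condMean κ z) - t) (κ z) :=
        (f.integrable_comp ((hi z hz).sub (integrable_const _))).sub (integrable_const t)
      refine (abs_integral_posPart_sub_le hfi' (hfi.sub (integrable_const c))).trans
        (le_of_eq ?_)
      have : ∀ v, |f (v - condMean κ z) - t - (f v - c)| =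
          |f (condMean κ x) - f (condMean κ z)| := fun v => by
        simp only [map_sub, hc]
        congr 1
        ring
      simp only [Pi.sub_apply, this, integral_const, probReal_univ, one_smul]
    · have h3 := (tendsto_const_nhds (x := f (condMean κ x))).sub hm
      rw [sub_self] at h3
      simpa using h3.abs
  have h3 := h2.add h1
  simp only [sub_add_cancel, zero_add] at h3
  convert h3 using 4 with v
  · simp only [map_sub, hc]
    congr 1
    ring

section Support

variable {C : Type*} [TopologicalSpace C] [MeasurableSpace C] {p : ℕ}
  {κY : Kernel C ℝ} [IsMarkovKernel κY] {κX : Kernel C (EuclideanSpace ℝ (Fin p))}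
  [IsMarkovKernel κX]

/-- The closed condition `b ∈ convexOrderSlopes κY κX x` extends from almost every point to every
point of the support at which the conditional laws are determined. -/
lemma mem_convexOrderSlopes_of_mem_support [HereditarilyLindelofSpace C] {μ : Measure C}
    (hY : ∀ x ∈ μ.support, Integrable (fun y => y) (κY x))
    (hX : ∀ x ∈ μ.support, Integrable (fun v => v) (κX x)) {b : EuclideanSpace ℝ (Fin p)}
    (hb : ∀ᵐ x ∂μ, b ∈ convexOrderSlopes κY κX x) {x : C} (hx : x ∈ μ.support)
    (hxc : 0 < μ {x} ∨
      (W1ContinuousWithinAt κY μ.support x ∧ W1ContinuousWithinAt κX μ.support x)) :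
    b ∈ convexOrderSlopes κY κX x := by
  rcases hxc with hat | ⟨hWY, hWX⟩
  · by_contra hn
    exact hat.ne' (measure_mono_null (Set.singleton_subset_iff.2 hn) (ae_iff.1 hb))
  · intro t
    set S := μ.support ∩ {z | b ∈ convexOrderSlopes κY κX z} with hS
    have hSae : S ∈ ae μ := inter_mem Measure.support_mem_ae hb
    -- Every neighbourhood of a support point has positive mass, so it meets the full-measure set of
    -- good points.
    have hcl : x ∈ closure S := by
      rw [mem_closure_iff_nhds]
      intro U hU
      have hpos := (Measure.mem_support_iff_forall x).1 hx U hU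
      rw [← measure_inter_conull (t := S) (by rwa [mem_ae_iff] at hSae)] at hpos
      exact nonempty_of_measure_ne_zero hpos.ne'
    have hne : (𝓝[S] x).NeBot := mem_closure_iff_nhdsWithin_neBot.1 hcl
    have hle : 𝓝[S] x ≤ 𝓝[μ.support] x := nhdsWithin_mono x Set.inter_subset_left
    have h1 := (tendsto_integral_posPart_of_W1 hx hX hWX (innerSL ℝ b) t).mono_left hle
    have h2 := (tendsto_integral_posPart_of_W1 hx hY hWY (ContinuousLinearMap.id ℝ ℝ) t).mono_left
      hle
    simp only [innerSL_apply_apply, ← real_inner_comm b] at h1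
    refine le_of_tendsto_of_tendsto h1 h2 ?_
    filter_upwards [self_mem_nhdsWithin] with z hz
    simpa using hz.2 t

end Support

end

theorem proposition2 {Ω : Type*} [MeasurableSpace Ω] (P : Measure Ω) [IsProbabilityMeasure P]
    (p d : ℕ) (hp : 1 ≤ p)
    (Y : Ω → ℝ) (Xnc : Ω → EuclideanSpace ℝ (Fin p)) (Xc : Ω → EuclideanSpace ℝ (Fin d))
    (hY : Measurable Y) (hXnc : Measurable Xnc) (hXc : Measurable Xc)
    (hY2 : MemLp Y 2 P)
    -- any versions of the conditional laws of `Y` and of `Xnc` given `Xc`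
    (κY : Kernel (EuclideanSpace ℝ (Fin d)) ℝ) [IsMarkovKernel κY]
    (κX : Kernel (EuclideanSpace ℝ (Fin d)) (EuclideanSpace ℝ (Fin p))) [IsMarkovKernel κX]
    (hκY : HasCondDistrib Y Xc κY P) (hκX : HasCondDistrib Xnc Xc κX P)
    -- the conditional second moments of `Xnc` exist and the conditional variance is nonsingular
    (hmom : ∀ᵐ x ∂(P.map Xc), MemLp (fun v => v) 2 (κX x))
    (hns : ∀ᵐ x ∂(P.map Xc), IsUnit (condCovMatrix κX x))
    -- the partially linear model
    (f0 : EuclideanSpace ℝ (Fin d) → ℝ) (hf0 : Measurable f0) (β0 : EuclideanSpace ℝ (Fin p))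
    (hPLM : P[Y | MeasurableSpace.comap (fun ω => (Xc ω, Xnc ω)) inferInstance]
      =ᵐ[P] fun ω => f0 (Xc ω) + inner ℝ (Xnc ω) β0) :
    let B : Set (EuclideanSpace ℝ (Fin p)) :=
      identifiedSlope (P.map fun ω => (Xc ω, Y ω)) (P.map fun ω => (Xc ω, Xnc ω))
    let supp : Set (EuclideanSpace ℝ (Fin d)) := (P.map Xc).support
    B = starSet (fun q => essInf (condRadialS κY κX q) (P.map Xc)) ∧
    -- if the conditional laws are determined at every point of the support, by an atom or by
    -- continuity, then the essential infimum is the infimum over the support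
    ((∀ x ∈ supp, Integrable (fun y => y) (κY x) ∧ MemLp (fun v => v) 2 (κX x) ∧
          IsUnit (condCovMatrix κX x) ∧
          (0 < P.map Xc {x} ∨ (W1ContinuousWithinAt κY supp x ∧ W1ContinuousWithinAt κX supp x))) →
        B = starSet (fun q => ⨅ x ∈ supp, condRadialS κY κX q x)) ∧
    identifiedFun (P.map fun ω => (Xc ω, Y ω)) (P.map fun ω => (Xc ω, Xnc ω)) =
      {g | Measurable g ∧ ∃ b ∈ B,
        g =ᵐ[P.map Xc] fun x => condMean κY x - inner ℝ (condMean κX x) b} ∧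
    (0 : EuclideanSpace ℝ (Fin p)) ∈ B ∧ IsCompact B ∧ Convex ℝ B := by
  intro B supp
  set μ := P.map Xc with hμ
  have hμp : IsProbabilityMeasure μ := Measure.isProbabilityMeasure_map hXc.aemeasurable
  have eY : (P.map fun ω => (Xc ω, Y ω)) = μ ⊗ₘ κY := hκY.map_eq
  have eX : (P.map fun ω => (Xc ω, Xnc ω)) = μ ⊗ₘ κX := hκX.map_eq
  have hYi : Integrable Prod.snd (μ ⊗ₘ κY) := by
    rw [← eY]
    exact (integrable_map_measure measurable_snd.aestronglyMeasurable
      (hXc.prodMk hY).aemeasurable).2 (hY2.integrable (by norm_num))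
  have hYae := ae_integrable_of_compProd hYi
  have hXae : ∀ᵐ x ∂μ, Integrable (fun v => v) (κX x) :=
    hmom.mono fun x hx => hx.integrable (by norm_num)
  have hrat : ∀ b g, Measurable g → (Rationalizes (μ ⊗ₘ κY) (μ ⊗ₘ κX) b g ↔
      (∀ᵐ x ∂μ, b ∈ convexOrderSlopes κY κX x) ∧
        g =ᵐ[μ] fun x => condMean κY x - inner ℝ (condMean κX x) b) := fun b g hg =>
    ⟨fun h => ⟨h.ae_mem_convexOrderSlopes hYi hXae hg, h.ae_eq hYi hXae hg⟩,
      fun h => rationalizes_of_ae_mem_convexOrderSlopes hYi hXae hg h.2 h.1⟩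
  have hmean : ∀ b, Measurable fun x => condMean κY x - inner ℝ (condMean κX x) b := fun b =>
    (stronglyMeasurable_condMean κY).measurable.sub
      ((stronglyMeasurable_condMean κX).measurable.inner_const)
  have hB : ∀ b, b ∈ B ↔ ∀ᵐ x ∂μ, b ∈ convexOrderSlopes κY κX x := by
    intro b
    simp only [B, identifiedSlope, eY, eX]
    constructor
    · rintro ⟨g, hg, h⟩
      exact ((hrat b g hg).1 h).1
    · intro h
      exact ⟨_, hmean b, (hrat b _ (hmean b)).2 ⟨h, EventuallyEq.rfl⟩⟩
  have hne : ∀ {q : EuclideanSpace ℝ (Fin p)}, ‖q‖ = 1 → q ≠ 0 := fun hq h0 => by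
    simp [h0] at hq
  refine ⟨?_, ?_, ?_, ?_, ?_, ?_⟩
  · refine eq_starSet hp fun q hq l hl => ?_
    rw [hB]
    have hiff : ∀ᵐ x ∂μ, ((l : EReal) ≤ condRadialS κY κX q x ↔
        l • q ∈ convexOrderSlopes κY κX x) := by
      filter_upwards [hYae, hmom, hns] with x h1 h2 h3 using le_condRadialS_iff h1 h2 h3 (hne hq) hl
    constructor
    · intro h
      filter_upwards [hiff, ae_essInf_le (μ := μ) (f := condRadialS κY κX q)] with x h1 h2
        using h1.1 (h.trans h2)
    · intro h
      refine le_essInf_of_ae_le _ ?_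
      filter_upwards [hiff, h] with x h1 h2 using h1.2 h2
  · intro hs
    refine eq_starSet hp fun q hq l hl => ?_
    rw [hB, le_iInf₂_iff]
    have hiff : ∀ x ∈ supp, ((l : EReal) ≤ condRadialS κY κX q x ↔
        l • q ∈ convexOrderSlopes κY κX x) := fun x hx =>
      le_condRadialS_iff (hs x hx).1 (hs x hx).2.1 (hs x hx).2.2.1 (hne hq) hl
    constructor
    · intro h
      filter_upwards [Measure.support_mem_ae (μ := μ)] with x hx using (hiff x hx).1 (h x hx)
    · intro h x hx
      exact (hiff x hx).2 (mem_convexOrderSlopes_of_mem_support (fun x hx => (hs x hx).1)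
        (fun x hx => (hs x hx).2.1.integrable (by norm_num)) h hx (hs x hx).2.2.2)
  · ext g
    simp only [identifiedFun, eY, eX]
    constructor
    · rintro ⟨hg, b, hb⟩
      have h := (hrat b g hg).1 hb
      exact ⟨hg, b, (hB b).2 h.1, h.2⟩
    · rintro ⟨hg, b, hb, hgb⟩
      exact ⟨hg, b, (hrat b g hg).2 ⟨(hB b).1 hb, hgb⟩⟩
  · exact (hB 0).2 (hYae.mono fun x hx => zero_mem_convexOrderSlopes hx)
  · refine Metric.isCompact_of_isClosed_isBounded (IsSeqClosed.isClosed fun b c hb hbc => ?_) ?_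
    · rw [hB]
      filter_upwards [hXae, ae_all_iff.2 fun n => (hB (b n)).1 (hb n)] with x hx hbx
      exact (isClosed_convexOrderSlopes hx).mem_of_tendsto hbc (Eventually.of_forall hbx)
    -- The null set depends on `b`, and `B` may be uncountable. A countable dense subset lies in the
    -- admissible slopes of one common `x`, and closedness then places all of `B` in that bounded
    -- set.
    · obtain ⟨D, hDB, hDc, hD⟩ :=
        (TopologicalSpace.IsSeparable.of_separableSpace B).exists_countable_dense_subset
      have hDae : ∀ᵐ x ∂μ, ∀ b ∈ D, b ∈ convexOrderSlopes κY κX x :=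
        (ae_ball_iff hDc).2 fun b hb => (hB b).1 (hDB hb)
      obtain ⟨x, h1, h2, h3, h4⟩ := (hYae.and (hmom.and (hns.and hDae))).exists
      refine (isBounded_convexOrderSlopes h1 h2 h3).subset (hD.trans ?_)
      exact closure_minimal h4 (isClosed_convexOrderSlopes (h2.integrable (by norm_num)))
  · intro b hb c hc r s hr hs hrs
    rw [hB] at hb hc ⊢
    filter_upwards [hXae, hb, hc] with x hx h1 h2
    exact convex_convexOrderSlopes hx h1 h2 hr hs hrs
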